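/- \textbf{Theorem (Standard fan-beam backprojection theorem).} Let $D>0$, write $\xi_\theta=(\cos\theta,\sin\theta)$ and let $r_\beta=D(-\sin\beta,\cos\beta)$ be the position of the source. Let $w=w(\gamma,\beta)$ be a standard fan-beam sinogram, i.e. a real-valued integrable function on $\mathbb R/\pi\mathbb Z\times\mathbb R/2\pi\mathbb Z$. Its fan-beam backprojection is $$\mathcal B_{\mathsf s}w(x)=\int_0^{2\pi}\frac{1}{L_\beta}\,w(\gamma_\beta,\beta)\,d\beta,\qquad x\in\mathbb R^2,$$ where $L_\beta=\|r_\beta-x\|_2$ and $\gamma_\beta$ is the angle of $x$ within the fan, given by $\cos\gamma_\beta=\frac{1}{DL_\beta}\,r_\beta\cdot(r_\beta-x)$ and $\sin\gamma_\beta=\frac{1}{L_\beta}\,x\cdot\xi_\beta$. Put $Z(\gamma,\theta)=w(\gamma,\theta-\gamma)$ and, for $n\ge 0$, $$c_n(\theta)=\frac1{2\pi}\int_0^{2\pi}Z(\gamma,\theta)e^{-in\gamma}\,d\gamma,\qquad b_0=2\pi c_0,\qquad b_n=2\pi\bigl[c_n+(-1)^n\overline{c_n}\bigr]\quad(n\ge1),$$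 and let $J_n(x)=\sum_{m\ge0}\frac{(-1)^m}{m!\,(m+n)!}\left(\frac x2\right)^{2m+n}$ be the Bessel functions of the first kind. Then $\mathcal B_{\mathsf s}w$ is a tempered function on $\mathbb R^2$ (it is integrable against some negative power of $1+\|x\|$), and its Fourier transform, taken in the sense of tempered distributions with the normalization $\hat\varphi(\xi)=\frac1{2\pi}\int_{\mathbb R^2}e^{-ix\cdot\xi}\varphi(x)\,dx$, is a tempered function which in polar frequency coordinates is $$\widehat{\mathcal B_{\mathsf s}w}(\sigma\xi_\theta)=\frac1\sigma\sum_{n=0}^\infty b_n(\theta)J_n(D\sigma),\qquad \sigma>0,\ \theta\in\mathbb R/2\pi\mathbb Z,$$ where the series converges absolutely for all $\sigma>0$ and all $\theta$. (For the null set of $\theta$ for which $Z(\cdot,\theta)$ may fail to be integrable, $c_n(\theta)$ is set to $0$.) -/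

import Mathlib

open scoped SchwartzMap

noncomputable section

namespace FanBeam

/-- The Euclidean plane. -/
abbrev Plane : Type := EuclideanSpace ℝ (Fin 2)

/-- The unit vector `ξ_θ = (cos θ, sin θ)`. -/
def xi (θ : ℝ) : Plane := !₂[Real.cos θ, Real.sin θ]

/-- The position `r_β = D (-sin β, cos β)` of the source: the common point of all the lines
`{x | x · ξ_{β+γ} = D sin γ}` of the fan with parameter `β`. -/
def source (D β : ℝ) : Plane := !₂[-(D * Real.sin β), D * Real.cos β]

/-- The angle `γ_β` of the point `x` within the fan `β`: with `L = ‖r_β - x‖`,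
`cos γ_β = r_β · (r_β - x) / (D L)` and `sin γ_β = x · ξ_β / L`. Equivalently, `x` lies on
the line `{y | y · ξ_{β+γ_β} = D sin γ_β}`. -/
def fanAngle (D : ℝ) (x : Plane) (β : ℝ) : ℝ :=
  Complex.arg ⟨inner ℝ (source D β) (source D β - x) / D, inner ℝ x (xi β)⟩

/-- Standard fan-beam sinograms: real integrable functions `w (γ, β)` on
`ℝ/πℤ × ℝ/2πℤ`, written as functions on `ℝ × ℝ` with these periods. -/
structure IsStandardSinogram (w : ℝ → ℝ → ℝ) : Prop where
  periodic_fst : ∀ γ β, w (γ + Real.pi) β = w γ β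
  periodic_snd : ∀ γ β, w γ (β + 2 * Real.pi) = w γ β
  integrable : MeasureTheory.IntegrableOn (Function.uncurry w)
    (Set.Ioc 0 Real.pi ×ˢ Set.Ioc 0 (2 * Real.pi))

/-- The fan-beam backprojection
`B_s w (x) = ∫_0^{2π} (1 / ‖r_β - x‖) w (γ_β, β) dβ`. -/
def fanBackprojection (D : ℝ) (w : ℝ → ℝ → ℝ) (x : Plane) : ℝ :=
  ∫ β in (0 : ℝ)..(2 * Real.pi), 1 / ‖source D β - x‖ * w (fanAngle D x β) β

/-- The sheared sinogram `Z (γ, θ) = w (γ, θ - γ)`. -/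
def sheared (w : ℝ → ℝ → ℝ) (γ θ : ℝ) : ℝ := w γ (θ - γ)

/-- `c_n (θ) = (1 / 2π) ∫_0^{2π} Z (γ, θ) e^{-i n γ} dγ`. -/
def coeffC (w : ℝ → ℝ → ℝ) (n : ℕ) (θ : ℝ) : ℂ :=
  1 / (2 * Real.pi) * ∫ γ in (0 : ℝ)..(2 * Real.pi),
    (sheared w γ θ : ℂ) * Complex.exp (-(Complex.I * n * γ))

/-- `b_0 = 2π c_0`, and `b_n = 2π (c_n + (-1)^n conj c_n)` for `n ≥ 1`. -/
def coeffB (w : ℝ → ℝ → ℝ) (n : ℕ) (θ : ℝ) : ℂ :=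
  if n = 0 then 2 * Real.pi * coeffC w 0 θ
  else 2 * Real.pi * (coeffC w n θ + (-1) ^ n * (starRingEnd ℂ) (coeffC w n θ))

/-- The Bessel function of the first kind of integer order `n ≥ 0`,
`J_n (x) = ∑_{m ≥ 0} (-1)^m / (m! (m + n)!) (x / 2)^{2m+n}`. -/
def besselJ (n : ℕ) (x : ℝ) : ℝ :=
  ∑' m : ℕ, (-1) ^ m / ((m.factorial : ℝ) * ((m + n).factorial : ℝ)) * (x / 2) ^ (2 * m + n)

/-- The Fourier transform of functions on the plane, in angular frequency and with the unitary
normalization: `(1 / 2π) ∫ e^{-i x · ξ} φ (x) dx`. -/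
def fourierPlane (φ : Plane → ℂ) (ξ : Plane) : ℂ :=
  1 / (2 * Real.pi) * ∫ x : Plane, Complex.exp (-(Complex.I * (inner ℝ x ξ : ℝ))) * φ x

/-- `g` is a measurable function that is integrable against some negative power of `1 + ‖x‖`;
such a function defines a tempered distribution. -/
def IsTempered (g : Plane → ℂ) : Prop :=
  ∃ k : ℕ, MeasureTheory.Integrable fun x : Plane => g x / ((1 + ‖x‖ : ℝ) : ℂ) ^ k

/-- The function `F` is the Fourier transform of the function `g` in the sense of tempered
distributions: `∫ g φ̂ = ∫ F φ` for every Schwartz function `φ`. -/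
def HasFourierTransform (g F : Plane → ℂ) : Prop :=
  IsTempered g ∧ IsTempered F ∧
    ∀ φ : 𝓢(Plane, ℂ), ∫ x, g x * fourierPlane φ x = ∫ ξ, F ξ * φ ξ

end FanBeam

end

/-!
For a test function `G` of quadratic decay, the change of variables `x = r_β - L e_{β+γ}`, where
`e_θ = (-sin θ, cos θ)`, has Jacobian `L`, which cancels the weight `1 / L_β` of the backprojection.
It therefore turns `∫ B_s w · G` into the integral of `w (γ, β)` against the integrals of `G` over
the rays from the sources. With `θ = β + γ` the ray lies on the line `x · ξ_θ = D sin γ`, and `w`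
becomes the sheared sinogram `Z (γ, θ)`. This is `integral_fanBackprojection_mul_eq_square`.
Likewise polar coordinates turn the integral of `F φ`, with
`F (σ ξ_θ) = σ⁻¹ ∫ Z (γ, θ) e^{-i D σ sin γ} dγ`, into the integral of `Z` against integrals of
`e^{-i D σ sin γ} φ` over rays from the origin: `integral_fanSpectrum_mul_eq_square`.

The function `Z` is invariant under `(γ, θ) ↦ (γ + π, θ + π)`, and this map exchanges the two
halves of each of the lines involved. After symmetrization both sides are integrals of `Z` against
integrals over full lines (`rayIntegral_add`, `waveIntegral_add`), and for `G = φ̂` these agree by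
the Fourier slice theorem (`integral_line_fourierPlane`). Hence `F` is the Fourier transform of
`B_s w`. Temperedness follows from the same changes of variables with `G = (1 + ‖x‖)⁻²`.

The expansion of `F` is that of Jacobi and Anger. The double series of
`e^{-i z sin γ} = e^{z t / 2} e^{-z t⁻¹ / 2}`, `t = e^{-iγ}`, converges absolutely and may be
integrated against `Z (·, θ)` term by term; collecting the terms in which the exponents of `t` and
`t⁻¹` have a given difference produces the Bessel functions (`hasSum_coeffB_mul_besselJ`). If
`Z (·, θ)` is not integrable, both sides are `0`.
-/

noncomputable section

namespace FanBeam

open MeasureTheory Set Filter Topology Complex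

/-! ### Complex coordinates adapted to the fan -/

/-- The identification of `ℂ` with the plane, `x + i y ↦ (x, y)`, as a linear isometry. -/
def planeIso : ℂ ≃ₗᵢ[ℝ] Plane := Complex.orthonormalBasisOneI.repr

lemma planeIso_apply (z : ℂ) : planeIso z = !₂[z.re, z.im] := by
  ext i
  fin_cases i <;> simp [planeIso]

lemma xi_eq_planeIso (θ : ℝ) : xi θ = planeIso (exp (θ * I)) := by
  rw [planeIso_apply, exp_ofReal_mul_I_re, exp_ofReal_mul_I_im, xi]

lemma source_eq_planeIso (D β : ℝ) : source D β = planeIso (I * exp (β * I) * D) := by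
  rw [planeIso_apply, source]
  congr 1
  simp [exp_ofReal_mul_I_re, exp_ofReal_mul_I_im, mul_comm D]

lemma inner_planeIso (z z' : ℂ) :
    inner ℝ (planeIso z) (planeIso z') = z.re * z'.re + z.im * z'.im := by
  rw [LinearIsometryEquiv.inner_map_map, Complex.inner]
  simp [mul_comm]

/-- The position of `x` relative to the source `r_β`, in the complex coordinate in which the ray
from the source to the origin is the positive real axis. It is `L_β e^{i γ_β}`, where `L_β` is the
distance from the source and `γ_β` is the angle within the fan. -/
def fanCoord (D β : ℝ) (x : Plane) : ℂ := D - planeIso.symm x / (I * exp (β * I))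

lemma I_mul_exp_ne_zero (β : ℝ) : I * exp (β * I) ≠ 0 := mul_ne_zero I_ne_zero (exp_ne_zero _)

lemma norm_I_mul_exp (β : ℝ) : ‖I * exp (β * I)‖ = 1 := by simp [norm_exp_ofReal_mul_I]

lemma planeIso_fanCoord (D β : ℝ) (x : Plane) :
    planeIso (I * exp (β * I) * (D - fanCoord D β x)) = x := by
  have : I * exp (β * I) * (D - fanCoord D β x) = planeIso.symm x := by
    rw [fanCoord, sub_sub_cancel, mul_div_cancel₀ _ (I_mul_exp_ne_zero β)]
  rw [this, LinearIsometryEquiv.apply_symm_apply]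

lemma source_sub (D β : ℝ) (x : Plane) :
    source D β - x = planeIso (I * exp (β * I) * fanCoord D β x) := by
  conv_lhs => rw [← planeIso_fanCoord D β x, source_eq_planeIso, ← map_sub]
  congr 1
  ring

lemma norm_source_sub (D β : ℝ) (x : Plane) : ‖source D β - x‖ = ‖fanCoord D β x‖ := by
  rw [source_sub, LinearIsometryEquiv.norm_map, norm_mul, norm_I_mul_exp, one_mul]

lemma fanAngle_eq_arg {D : ℝ} (hD : D ≠ 0) (x : Plane) (β : ℝ) :
    fanAngle D x β = arg (fanCoord D β x) := by
  rw [fanAngle]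
  congr 1
  rw [source_sub]
  conv_lhs => rw [← planeIso_fanCoord D β x]
  rw [planeIso_fanCoord, xi_eq_planeIso]
  conv_lhs =>
    enter [2]
    rw [← planeIso_fanCoord D β x]
  rw [source_eq_planeIso, inner_planeIso, inner_planeIso]
  have h := Real.sin_sq_add_cos_sq β
  apply Complex.ext
  · simp [exp_ofReal_mul_I_re, exp_ofReal_mul_I_im]
    field_simp
    linear_combination (fanCoord D β x).re * h
  · simp [exp_ofReal_mul_I_re, exp_ofReal_mul_I_im]
    linear_combination (fanCoord D β x).im * h

lemma measurePreserving_fanCoord (D β : ℝ) : MeasurePreserving (fanCoord D β) := by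
  have h1 := planeIso.symm.measurePreserving
  have h2 := (rotation (Circle.exp β)⁻¹).measurePreserving
  have h3 := (rotation (Circle.exp (-(Real.pi / 2)))).measurePreserving
  have h4 := Measure.measurePreserving_sub_left (volume : Measure ℂ) (D : ℂ)
  have h : fanCoord D β = (fun t => (D : ℂ) - t) ∘ rotation (Circle.exp (-(Real.pi / 2))) ∘
      rotation (Circle.exp β)⁻¹ ∘ planeIso.symm := by
    funext x
    simp only [fanCoord, Function.comp_apply, rotation_apply, Circle.coe_inv, Circle.coe_exp]
    have : exp (((-(Real.pi / 2) : ℝ) : ℂ) * I) = I⁻¹ := by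
      rw [inv_I, ← exp_neg_pi_div_two_mul_I]
      push_cast
      ring_nf
    rw [this, div_eq_mul_inv, mul_inv]
    ring
  rw [h]
  exact h4.comp (h3.comp (h2.comp h1))

lemma continuous_fanCoord (D : ℝ) : Continuous fun p : ℝ × Plane => fanCoord D p.1 p.2 := by
  unfold fanCoord
  refine continuous_const.sub (Continuous.div ?_ ?_ fun p => I_mul_exp_ne_zero _)
  · exact planeIso.symm.continuous.comp continuous_snd
  · fun_prop

lemma measurableEmbedding_fanCoord (D β : ℝ) : MeasurableEmbedding (fanCoord D β) := by
  have hr : range (fanCoord D β) = univ := by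
    refine range_eq_univ.2 fun y => ⟨planeIso (I * exp (β * I) * (D - y)), ?_⟩
    rw [fanCoord, LinearIsometryEquiv.symm_apply_apply,
      mul_div_cancel_left₀ _ (I_mul_exp_ne_zero β), sub_sub_cancel]
  refine MeasurableEmbedding.of_measurable_inverse
    (g := fun y => planeIso (I * exp (β * I) * (D - y)))
    (measurePreserving_fanCoord D β).measurable (hr ▸ MeasurableSet.univ) ?_
    fun x => planeIso_fanCoord D β x
  exact planeIso.continuous.measurable.comp (by fun_prop)

/-! ### Polar coordinates -/

lemma arg_polarCoord_symm {p : ℝ × ℝ} (hp : p ∈ Ioi (0 : ℝ) ×ˢ Ioo (-Real.pi) Real.pi) :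
    arg (Complex.polarCoord.symm p) = p.2 := by
  rw [Complex.polarCoord_symm_apply]
  exact_mod_cast arg_mul_cos_add_sin_mul_I hp.1 ⟨hp.2.1, hp.2.2.le⟩

/-- Null sets of angles are null sets of the plane, so that a sinogram, which is only measurable up
to a null set, can be composed with the angle. -/
lemma quasiMeasurePreserving_arg :
    Measure.QuasiMeasurePreserving arg (volume : Measure ℂ)
      (volume.restrict (Ioo (-Real.pi) Real.pi)) := by
  refine ⟨measurable_arg, Measure.AbsolutelyContinuous.mk fun N hN hN0 => ?_⟩
  rw [Measure.map_apply measurable_arg hN, ← lintegral_indicator_one (measurable_arg hN),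
    ← Complex.lintegral_comp_polarCoord_symm, polarCoord_target, Measure.volume_eq_prod,
    ← Measure.prod_restrict]
  refine lintegral_eq_zero_of_ae_eq_zero ?_
  have h0 : ((volume.restrict (Ioi (0 : ℝ))).prod (volume.restrict (Ioo (-Real.pi) Real.pi)))
      (univ ×ˢ N) = 0 := by
    rw [Measure.prod_prod, hN0, mul_zero]
  have h1 : ∀ᵐ p : ℝ × ℝ ∂((volume.restrict (Ioi (0 : ℝ))).prod
      (volume.restrict (Ioo (-Real.pi) Real.pi))), p ∈ Ioi (0 : ℝ) ×ˢ Ioo (-Real.pi) Real.pi := by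
    rw [Measure.prod_restrict]
    exact ae_restrict_mem (measurableSet_Ioi.prod measurableSet_Ioo)
  filter_upwards [measure_eq_zero_iff_ae_notMem.1 h0, h1] with p hp hp1
  have := arg_polarCoord_symm hp1
  have h2 : p.2 ∉ N := fun h => hp ⟨trivial, h⟩
  have h3 : Complex.polarCoord.symm p ∉ arg ⁻¹' N := by rwa [mem_preimage, this]
  simp only [indicator_of_notMem h3, smul_zero, Pi.zero_apply]

lemma integrableOn_inv_one_add_sq : IntegrableOn (fun r : ℝ => ((1 + r) ^ 2)⁻¹) (Ioi 0) := by
  refine (integrableOn_add_rpow_Ioi_of_lt (m := 1) (a := -2) (by norm_num) (by norm_num)).congr_fun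
    (fun r hr => ?_) measurableSet_Ioi
  have : (0 : ℝ) < r + 1 := by have := mem_Ioi.1 hr; linarith
  simp only []
  rw [Real.rpow_neg this.le, add_comm]
  norm_cast

section Polar

variable {α : Type*} [MeasurableSpace α] {μ : Measure α} [SFinite μ]

/-- The radial factor `‖y‖⁻¹` cancels the Jacobian of polar coordinates. -/
lemma integral_polar_section (u : ℝ → ℂ) (h : ℂ → ℂ) :
    ∫ y : ℂ, (‖y‖⁻¹ : ℝ) * u (arg y) * h y =
      ∫ p in Ioi (0 : ℝ) ×ˢ Ioo (-Real.pi) Real.pi, u p.2 * h (p.1 * exp (p.2 * I)) := by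
  rw [← Complex.integral_comp_polarCoord_symm, polarCoord_target]
  refine setIntegral_congr_fun (measurableSet_Ioi.prod measurableSet_Ioo) fun p hp => ?_
  have hp0 : (0 : ℝ) < p.1 := hp.1
  have := arg_polarCoord_symm hp
  simp only [this, norm_polarCoord_symm, abs_of_pos hp0, real_smul]
  rw [Complex.polarCoord_symm_apply, exp_mul_I]
  push_cast
  have : (p.1 : ℂ) ≠ 0 := by exact_mod_cast hp0.ne'
  field_simp

lemma lintegral_polar_section (u : ℝ → ℂ) (h : ℂ → ℂ) :
    ∫⁻ y : ℂ, ‖(‖y‖⁻¹ : ℝ) * u (arg y) * h y‖ₑ =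
      ∫⁻ p in Ioi (0 : ℝ) ×ˢ Ioo (-Real.pi) Real.pi, ‖u p.2 * h (p.1 * exp (p.2 * I))‖ₑ := by
  rw [← Complex.lintegral_comp_polarCoord_symm, polarCoord_target]
  refine setLIntegral_congr_fun (measurableSet_Ioi.prod measurableSet_Ioo) fun p hp => ?_
  have hp0 : (0 : ℝ) < p.1 := hp.1
  have := arg_polarCoord_symm hp
  simp only [this, norm_polarCoord_symm, abs_of_pos hp0]
  rw [Complex.polarCoord_symm_apply, exp_mul_I, smul_eq_mul,
    show ENNReal.ofReal p.1 = ‖(p.1 : ℂ)‖ₑ by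
      rw [← ofReal_norm, norm_real, Real.norm_of_nonneg hp0.le], ← enorm_mul]
  push_cast
  have : (p.1 : ℂ) ≠ 0 := by exact_mod_cast hp0.ne'
  congr 1
  field_simp

/-- A function of the angle that is integrable on bounded sets of angles becomes integrable on the
plane with the factor `‖y‖⁻¹` and a weight of quadratic decay, uniformly in a parameter. -/
lemma integrable_polar {v : α → ℝ → ℂ} {H : α → ℂ → ℂ} {C : ℝ}
    (hv : Integrable (Function.uncurry v) (μ.prod (volume.restrict (Ioo (-Real.pi) Real.pi))))
    (hH : AEStronglyMeasurable (Function.uncurry H) (μ.prod volume))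
    (hC : ∀ a y, ‖H a y‖ ≤ C * ((1 + ‖y‖) ^ 2)⁻¹) :
    Integrable (fun p : α × ℂ => (‖p.2‖⁻¹ : ℝ) * v p.1 (arg p.2) * H p.1 p.2)
      (μ.prod volume) := by
  have hm : AEStronglyMeasurable
      (fun p : α × ℂ => (‖p.2‖⁻¹ : ℝ) * v p.1 (arg p.2) * H p.1 p.2) (μ.prod volume) := by
    refine AEStronglyMeasurable.mul (AEStronglyMeasurable.mul ?_ ?_) hH
    · exact (Complex.measurable_ofReal.comp measurable_snd.norm.inv).aestronglyMeasurable
    · exact hv.aestronglyMeasurable.comp_quasiMeasurePreserving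
        (MeasureTheory.QuasiMeasurePreserving.prodMap (.id μ) quasiMeasurePreserving_arg)
  refine ⟨hm, ?_⟩
  rw [HasFiniteIntegral, lintegral_prod _ hm.enorm]
  simp only [lintegral_polar_section]
  have hle : ∀ a, ∫⁻ p in Ioi (0 : ℝ) ×ˢ Ioo (-Real.pi) Real.pi,
      ‖v a p.2 * H a (p.1 * exp (p.2 * I))‖ₑ ≤
      ∫⁻ p in Ioi (0 : ℝ) ×ˢ Ioo (-Real.pi) Real.pi,
        ‖C * ((1 + p.1) ^ 2)⁻¹‖ₑ * ‖v a p.2‖ₑ := fun a => by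
    refine setLIntegral_mono' (measurableSet_Ioi.prod measurableSet_Ioo) fun p hp => ?_
    have hp0 : (0 : ℝ) < p.1 := hp.1
    rw [enorm_mul, mul_comm]
    gcongr
    rw [enorm_le_iff_norm_le]
    refine (hC _ _).trans ((Real.le_norm_self _).trans_eq' ?_)
    rw [norm_mul, norm_exp_ofReal_mul_I, norm_real, Real.norm_of_nonneg hp0.le, mul_one]
  refine (lintegral_mono hle).trans_lt ?_
  have hae : ∀ᵐ a ∂μ, AEMeasurable (v a) (volume.restrict (Ioo (-Real.pi) Real.pi)) :=
    hv.aestronglyMeasurable.prodMk_left.mono fun a ha => ha.aemeasurable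
  have heq : ∀ᵐ a ∂μ, ∫⁻ p in Ioi (0 : ℝ) ×ˢ Ioo (-Real.pi) Real.pi,
        ‖C * ((1 + p.1) ^ 2)⁻¹‖ₑ * ‖v a p.2‖ₑ =
      (∫⁻ r in Ioi (0 : ℝ), ‖C * ((1 + r) ^ 2)⁻¹‖ₑ) *
        ∫⁻ γ in Ioo (-Real.pi) Real.pi, ‖v a γ‖ₑ := by
    filter_upwards [hae] with a ha
    rw [Measure.volume_eq_prod, ← Measure.prod_restrict,
      lintegral_prod_mul (f := fun r : ℝ => ‖C * ((1 + r) ^ 2)⁻¹‖ₑ)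
        (g := fun γ => ‖v a γ‖ₑ) (by fun_prop) ha.enorm]
  rw [lintegral_congr_ae heq]
  have h1 := (integrableOn_inv_one_add_sq.const_mul C).2
  have h2 := hv.2
  rw [HasFiniteIntegral, lintegral_prod _ hv.aestronglyMeasurable.enorm] at h2
  rw [HasFiniteIntegral] at h1
  rw [lintegral_const_mul' _ _ h1.ne]
  exact ENNReal.mul_lt_top h1 h2

/-- Fubini and polar coordinates for a function that is `‖y‖⁻¹` times a function of the angle,
weighted with a factor of quadratic decay. -/
lemma integral_polar {v : α → ℝ → ℂ} {H : α → ℂ → ℂ} {C : ℝ}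
    (hv : Integrable (Function.uncurry v) (μ.prod (volume.restrict (Ioo (-Real.pi) Real.pi))))
    (hH : ∀ a, Continuous (H a))
    (hC : ∀ a y, ‖H a y‖ ≤ C * ((1 + ‖y‖) ^ 2)⁻¹) :
    ∫ a, (∫ y : ℂ, (‖y‖⁻¹ : ℝ) * v a (arg y) * H a y) ∂μ =
      ∫ a, (∫ γ in Ioo (-Real.pi) Real.pi,
        v a γ * ∫ r in Ioi (0 : ℝ), H a (r * exp (γ * I))) ∂μ := by
  refine integral_congr_ae ?_
  filter_upwards [hv.prod_right_ae] with a ha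
  have hp : Integrable (fun p : ℝ × ℝ => v a p.2 * H a (p.1 * exp (p.2 * I)))
      ((volume.restrict (Ioi (0 : ℝ))).prod (volume.restrict (Ioo (-Real.pi) Real.pi))) := by
    have hb : Integrable (fun p : ℝ × ℝ => C * ((1 + p.1) ^ 2)⁻¹ * ‖v a p.2‖)
      ((volume.restrict (Ioi (0 : ℝ))).prod (volume.restrict (Ioo (-Real.pi) Real.pi))) :=
      (integrableOn_inv_one_add_sq.const_mul C).mul_prod ha.norm
    refine hb.mono' ?_ ?_
    · refine AEStronglyMeasurable.mul ?_ ?_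
      · exact ha.aestronglyMeasurable.comp_snd
      · exact Continuous.aestronglyMeasurable ((hH a).comp (by fun_prop))
    · rw [Measure.prod_restrict]
      filter_upwards [ae_restrict_mem (measurableSet_Ioi.prod measurableSet_Ioo)] with p hp
      have hp0 : (0 : ℝ) < p.1 := hp.1
      rw [norm_mul, mul_comm]
      gcongr
      refine (hC _ _).trans_eq ?_
      rw [norm_mul, norm_exp_ofReal_mul_I, norm_real, Real.norm_of_nonneg hp0.le, mul_one]
  rw [integral_polar_section, Measure.volume_eq_prod, ← Measure.prod_restrict,
    integral_prod_symm _ hp]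
  simp only [integral_const_mul]

end Polar

/-! ### Periodic sinograms -/

/-- Shearing in the second variable preserves integrability over a period of that variable. -/
lemma integrable_comp_shear {ν : Measure ℝ} [SFinite ν] {f : ℝ → ℝ → ℂ} {T b : ℝ} (hT : 0 < T)
    (hf : AEStronglyMeasurable (Function.uncurry f) (ν.prod volume))
    (hper : ∀ s, Function.Periodic (f s) T)
    (hi : Integrable (Function.uncurry f) (ν.prod (volume.restrict (Ioc b (b + T)))))
    {c : ℝ → ℝ} (hc : Measurable c) (b' : ℝ) :
    Integrable (fun p : ℝ × ℝ => f p.1 (p.2 + c p.1))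
      (ν.prod (volume.restrict (Ioc b' (b' + T)))) := by
  have hmp : MeasurePreserving (fun p : ℝ × ℝ => (p.1, p.2 + c p.1))
      (ν.prod volume) (ν.prod volume) :=
    (MeasurePreserving.id ν).skew_product (g := fun s t => t + c s)
      (measurable_snd.add (hc.comp measurable_fst))
      (ae_of_all _ fun s => (measurePreserving_add_right volume (c s)).map_eq)
  have hm : AEStronglyMeasurable (fun p : ℝ × ℝ => f p.1 (p.2 + c p.1))
      (ν.prod (volume.restrict (Ioc b' (b' + T)))) := by
    refine (hf.comp_measurePreserving hmp).mono_ac ?_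
    exact Measure.AbsolutelyContinuous.rfl.prod Measure.restrict_le_self.absolutelyContinuous
  rw [integrable_prod_iff hm]
  rw [integrable_prod_iff hi.aestronglyMeasurable] at hi
  refine ⟨?_, ?_⟩
  · filter_upwards [hi.1] with s hs
    have h1 : IntervalIntegrable (f s) volume b (b + T) :=
      (intervalIntegrable_iff_integrableOn_Ioc_of_le (by linarith)).2 hs
    have h2 := ((hper s).intervalIntegrable hT.ne' h1 (b' + c s)
      (b' + T + c s)).comp_add_right (c s)
    rw [add_sub_cancel_right, add_sub_cancel_right] at h2
    exact (intervalIntegrable_iff_integrableOn_Ioc_of_le (by linarith)).1 h2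
  · refine hi.2.congr (ae_of_all _ fun s => ?_)
    have hn : Function.Periodic (fun t => ‖f s t‖) T := fun t => by simp only [hper s t]
    simp only [Function.uncurry_apply_pair]
    rw [← intervalIntegral.integral_of_le (by linarith),
      ← intervalIntegral.integral_of_le (by linarith),
      intervalIntegral.integral_comp_add_right (fun t => ‖f s t‖) (c s),
      add_right_comm b' T (c s)]
    exact hn.intervalIntegral_add_eq b (b' + c s)

namespace IsStandardSinogram

variable {w : ℝ → ℝ → ℝ}

/-- By periodicity the sinogram is integrable on every translate of its fundamental cell. -/
lemma integrableOn_cell (hw : IsStandardSinogram w) (m n : ℤ) : IntegrableOn (Function.uncurry w)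
    (Ioc (m * Real.pi) (m * Real.pi + Real.pi) ×ˢ
      Ioc (n * (2 * Real.pi)) (n * (2 * Real.pi) + 2 * Real.pi)) := by
  have hmp := measurePreserving_sub_right (volume : Measure (ℝ × ℝ))
    (m * Real.pi, n * (2 * Real.pi))
  have h := (hmp.integrableOn_comp_preimage (measurableEmbedding_subRight _)).2 hw.integrable
  have h1 : Function.uncurry w ∘ (fun p : ℝ × ℝ => p - (m * Real.pi, n * (2 * Real.pi))) =
      Function.uncurry w := by
    funext p
    have e1 : Function.Periodic (fun γ => w γ (p.2 - n * (2 * Real.pi))) Real.pi :=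
      fun γ => hw.periodic_fst _ _
    have e2 : Function.Periodic (w p.1) (2 * Real.pi) := fun γ => hw.periodic_snd _ _
    exact (e1.sub_int_mul_eq m).trans (e2.sub_int_mul_eq n)
  rw [h1] at h
  convert h using 1
  ext p
  simp only [mem_prod, mem_Ioc, mem_preimage, Prod.fst_sub, Prod.snd_sub, sub_pos,
    sub_le_iff_le_add']

lemma aestronglyMeasurable (hw : IsStandardSinogram w) :
    AEStronglyMeasurable (Function.uncurry w) := by
  have hU : (⋃ q : ℤ × ℤ, Ioc (q.1 * Real.pi) (q.1 * Real.pi + Real.pi) ×ˢ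
      Ioc (q.2 * (2 * Real.pi)) (q.2 * (2 * Real.pi) + 2 * Real.pi)) = univ := by
    refine eq_univ_of_forall fun p => ?_
    have h1 := iUnion_Ioc_zsmul Real.pi_pos
    have h2 := iUnion_Ioc_zsmul Real.two_pi_pos
    obtain ⟨m, hm⟩ := mem_iUnion.1 (h1 ▸ mem_univ p.1)
    obtain ⟨n, hn⟩ := mem_iUnion.1 (h2 ▸ mem_univ p.2)
    refine mem_iUnion.2 ⟨(m, n), ?_, ?_⟩
    · simpa [add_mul] using hm
    · simpa [add_mul] using hn
  rw [← Measure.restrict_univ (μ := (volume : Measure (ℝ × ℝ))), ← hU,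
    aestronglyMeasurable_iUnion_iff]
  exact fun q => (hw.integrableOn_cell q.1 q.2).aestronglyMeasurable

lemma periodic_fst_two_pi (hw : IsStandardSinogram w) (β : ℝ) :
    Function.Periodic (fun γ => w γ β) (2 * Real.pi) := fun γ => by
  simp only [two_mul, ← add_assoc, hw.periodic_fst]

lemma integrable_square (hw : IsStandardSinogram w) : Integrable (fun p : ℝ × ℝ => (w p.1 p.2 : ℂ))
    ((volume.restrict (Ioc 0 (0 + 2 * Real.pi))).prod
      (volume.restrict (Ioc 0 (0 + 2 * Real.pi)))) := by
  -- two cells, since the cell of definition has width `π` in `γ`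
  have h := (hw.integrableOn_cell 0 0).union (hw.integrableOn_cell 1 0)
  rw [← union_prod] at h
  simp only [Int.cast_zero, zero_mul, Int.cast_one, one_mul, zero_add] at h
  rw [Ioc_union_Ioc_eq_Ioc Real.pi_pos.le (by linarith [Real.pi_pos]), ← two_mul,
    IntegrableOn, Measure.volume_eq_prod, ← Measure.prod_restrict] at h
  rw [zero_add]
  exact h.ofReal

lemma sheared_add_two_pi (hw : IsStandardSinogram w) (γ θ : ℝ) :
    sheared w (γ + 2 * Real.pi) θ = sheared w γ θ := by
  have h2 : Function.Periodic (w γ) (2 * Real.pi) := hw.periodic_snd γ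
  rw [sheared, sheared, ← sub_sub]
  exact (hw.periodic_fst_two_pi _ γ).trans (h2.sub_eq _)

lemma sheared_periodic_snd (hw : IsStandardSinogram w) (γ : ℝ) :
    Function.Periodic (sheared w γ) (2 * Real.pi) := fun θ => by
  rw [sheared, sheared, add_sub_right_comm, hw.periodic_snd]

lemma sheared_add_pi_add_pi (hw : IsStandardSinogram w) (γ θ : ℝ) :
    sheared w (γ + Real.pi) (θ + Real.pi) = sheared w γ θ := by
  rw [sheared, sheared, hw.periodic_fst, add_sub_add_right_eq_sub]

lemma integrable_swap (hw : IsStandardSinogram w) (a : ℝ) :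
    Integrable (fun p : ℝ × ℝ => (w p.2 p.1 : ℂ))
    ((volume.restrict (Ioc 0 (2 * Real.pi))).prod
      (volume.restrict (Ioc a (a + 2 * Real.pi)))) := by
  have h := integrable_comp_shear (f := fun β γ => (w γ β : ℂ)) (b := 0) (c := fun _ => 0)
    (ν := volume.restrict (Ioc 0 (0 + 2 * Real.pi))) Real.two_pi_pos ?_ ?_
    hw.integrable_square.swap measurable_const a
  · simpa using h
  · have := (Complex.continuous_ofReal.comp_aestronglyMeasurable hw.aestronglyMeasurable).prod_swap
    refine this.mono_ac ?_
    exact Measure.restrict_le_self.absolutelyContinuous.prod Measure.AbsolutelyContinuous.rfl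
  · intro β γ
    simp only [hw.periodic_fst_two_pi β γ]

lemma integrable_sheared (hw : IsStandardSinogram w) (a b : ℝ) :
    Integrable (fun p : ℝ × ℝ => (sheared w p.1 p.2 : ℂ))
    ((volume.restrict (Ioc a (a + 2 * Real.pi))).prod
      (volume.restrict (Ioc b (b + 2 * Real.pi)))) := by
  have hm : AEStronglyMeasurable (fun p : ℝ × ℝ => (w p.1 p.2 : ℂ)) (volume.prod volume) :=
    Complex.continuous_ofReal.comp_aestronglyMeasurable hw.aestronglyMeasurable
  have h := integrable_comp_shear (f := fun γ β => (w γ β : ℂ)) (b := 0) (c := fun γ => -γ)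
    (ν := volume.restrict (Ioc 0 (0 + 2 * Real.pi))) Real.two_pi_pos ?_ ?_
    hw.integrable_square measurable_neg b
  · have h' := integrable_comp_shear (f := fun θ γ => (sheared w γ θ : ℂ)) (b := 0)
      (c := fun _ => 0) (ν := volume.restrict (Ioc b (b + 2 * Real.pi))) Real.two_pi_pos ?_ ?_
      h.swap measurable_const a
    · simpa [Function.comp_def] using h'.swap
    · have hmp : MeasurePreserving (fun p : ℝ × ℝ => (p.1, p.2 + -p.1))
          (volume.prod volume) (volume.prod volume) :=
        (MeasurePreserving.id volume).skew_product (g := fun s t => t + -s)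
          (measurable_snd.add measurable_fst.neg)
          (ae_of_all _ fun s => (measurePreserving_add_right volume (-s)).map_eq)
      refine (hm.comp_measurePreserving hmp).prod_swap.mono_ac ?_
      exact Measure.restrict_le_self.absolutelyContinuous.prod Measure.AbsolutelyContinuous.rfl
    · intro θ γ
      simp only [hw.sheared_add_two_pi]
  · refine hm.mono_ac ?_
    exact Measure.restrict_le_self.absolutelyContinuous.prod Measure.AbsolutelyContinuous.rfl
  · intro γ β
    simp only [hw.periodic_snd]

end IsStandardSinogram

/-! ### The backprojection and its spectrum as functionals -/

section Pairing

variable {D C : ℝ} {w : ℝ → ℝ → ℝ} {G : Plane → ℂ}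

lemma restrict_Ioc_pi_eq_Ioo :
    (volume : Measure ℝ).restrict (Ioc (-Real.pi) (-Real.pi + 2 * Real.pi)) =
    volume.restrict (Ioo (-Real.pi) Real.pi) := by
  rw [show -Real.pi + 2 * Real.pi = Real.pi by ring]
  exact (Measure.restrict_congr_set Ioo_ae_eq_Ioc).symm

/-- In coordinates relative to the source, quadratic decay is not lost. -/
lemma norm_comp_fan_le (hD : 0 < D) (hC : ∀ x, ‖G x‖ ≤ C * ((1 + ‖x‖) ^ 2)⁻¹) (β : ℝ) (y : ℂ) :
    ‖G (planeIso (I * exp (β * I) * (D - y)))‖ ≤ C * (1 + D) ^ 2 * ((1 + ‖y‖) ^ 2)⁻¹ := by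
  have hC0 : 0 ≤ C := by
    have := (norm_nonneg _).trans (hC 0)
    simpa using this
  refine (hC _).trans ?_
  rw [LinearIsometryEquiv.norm_map, norm_mul, norm_I_mul_exp, one_mul, mul_assoc]
  refine mul_le_mul_of_nonneg_left ?_ hC0
  rw [← div_eq_mul_inv, inv_le_comm₀ (by positivity) (by positivity), inv_div,
    div_le_iff₀ (by positivity), ← mul_pow]
  refine pow_le_pow_left₀ (by positivity) ?_ 2
  have h1 : ‖y‖ ≤ D + ‖(D : ℂ) - y‖ := by
    have := norm_sub_norm_le y (y - D)
    rw [sub_sub_cancel, norm_real, Real.norm_of_nonneg hD.le, norm_sub_rev y] at this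
    linarith
  nlinarith [norm_nonneg ((D : ℂ) - y)]

/-- The integrand that defines the backprojection, tested against `G`. -/
lemma integrable_fan_kernel (hD : 0 < D) (hw : IsStandardSinogram w) (hG : Continuous G)
    (hC : ∀ x, ‖G x‖ ≤ C * ((1 + ‖x‖) ^ 2)⁻¹) :
    Integrable (fun p : ℝ × Plane =>
      ((1 / ‖source D p.1 - p.2‖ * w (fanAngle D p.2 p.1) p.1 : ℝ) : ℂ) * G p.2)
      ((volume.restrict (Ioc 0 (2 * Real.pi))).prod volume) := by
  have hv := hw.integrable_swap (-Real.pi)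
  rw [restrict_Ioc_pi_eq_Ioo] at hv
  have h := integrable_polar (v := fun β γ => (w γ β : ℂ))
    (H := fun β y => G (planeIso (I * exp (β * I) * (D - y)))) hv
    (Continuous.aestronglyMeasurable (hG.comp (planeIso.continuous.comp (by fun_prop))))
    (norm_comp_fan_le hD hC)
  have hmp : MeasurePreserving (fun p : ℝ × Plane => (p.1, fanCoord D p.1 p.2))
      ((volume.restrict (Ioc 0 (2 * Real.pi))).prod volume)
      ((volume.restrict (Ioc 0 (2 * Real.pi))).prod volume) :=
    (MeasurePreserving.id _).skew_product (g := fun β x => fanCoord D β x)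
      (continuous_fanCoord D).measurable
      (ae_of_all _ fun β => (measurePreserving_fanCoord D β).map_eq)
  refine (hmp.integrable_comp_of_integrable h).congr (ae_of_all _ fun p => ?_)
  simp only [Function.comp_apply, planeIso_fanCoord, fanAngle_eq_arg hD.ne', norm_source_sub,
    one_div]
  push_cast
  rfl

lemma ofReal_fanBackprojection_mul (x : Plane) :
    (fanBackprojection D w x : ℂ) * G x = ∫ β in Ioc 0 (2 * Real.pi),
      ((1 / ‖source D β - x‖ * w (fanAngle D x β) β : ℝ) : ℂ) * G x := by
  rw [integral_mul_const, integral_complex_ofReal, fanBackprojection,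
    intervalIntegral.integral_of_le Real.two_pi_pos.le]

lemma integrable_fanBackprojection_mul (hD : 0 < D) (hw : IsStandardSinogram w)
    (hG : Continuous G) (hC : ∀ x, ‖G x‖ ≤ C * ((1 + ‖x‖) ^ 2)⁻¹) :
    Integrable fun x => (fanBackprojection D w x : ℂ) * G x := by
  simp only [ofReal_fanBackprojection_mul]
  exact (integrable_fan_kernel hD hw hG hC).integral_prod_right

/-- The adjoint of the backprojection integrates `G` over the rays of the fans. -/
lemma integral_fanBackprojection_mul (hD : 0 < D) (hw : IsStandardSinogram w)
    (hG : Continuous G) (hC : ∀ x, ‖G x‖ ≤ C * ((1 + ‖x‖) ^ 2)⁻¹) :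
    ∫ x, (fanBackprojection D w x : ℂ) * G x =
      ∫ β in Ioc 0 (2 * Real.pi), ∫ γ in Ioo (-Real.pi) Real.pi, (w γ β : ℂ) *
        ∫ r in Ioi (0 : ℝ), G (planeIso (I * exp (β * I) * (D - r * exp (γ * I)))) := by
  have hv := hw.integrable_swap (-Real.pi)
  rw [restrict_Ioc_pi_eq_Ioo] at hv
  simp only [ofReal_fanBackprojection_mul]
  rw [← integral_integral_swap (integrable_fan_kernel hD hw hG hC)]
  rw [← integral_polar (v := fun β γ => (w γ β : ℂ))
    (H := fun β y => G (planeIso (I * exp (β * I) * (D - y)))) hv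
    (fun β => hG.comp (planeIso.continuous.comp (by fun_prop)))
    (norm_comp_fan_le hD hC)]
  refine integral_congr_ae (ae_of_all _ fun β => ?_)
  simp only []
  rw [← (measurePreserving_fanCoord D β).integral_comp (measurableEmbedding_fanCoord D β)]
  refine integral_congr_ae (ae_of_all _ fun x => ?_)
  simp only [planeIso_fanCoord, fanAngle_eq_arg hD.ne', norm_source_sub, one_div]
  push_cast
  rfl

/-- The function `F (σ ξ_θ) = σ⁻¹ ∫_0^{2π} Z (γ, θ) e^{-i D σ sin γ} dγ`, the Fourier transform of
the backprojection before its expansion in Bessel functions. -/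
def fanSpectrum (D : ℝ) (w : ℝ → ℝ → ℝ) (x : Plane) : ℂ :=
  (‖x‖⁻¹ : ℝ) * ∫ γ in (0 : ℝ)..(2 * Real.pi),
    (sheared w γ (arg (planeIso.symm x)) : ℂ) * exp (-(I * (D * ‖x‖ * Real.sin γ : ℝ)))

lemma norm_exp_neg_I_mul (t : ℝ) : ‖exp (-(I * t))‖ = 1 := by
  rw [show -(I * (t : ℂ)) = ((-t : ℝ) : ℂ) * I by push_cast; ring, norm_exp_ofReal_mul_I]

lemma norm_wave_mul_le (hC : ∀ x, ‖G x‖ ≤ C * ((1 + ‖x‖) ^ 2)⁻¹) (γ : ℝ) (y : ℂ) :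
    ‖exp (-(I * (D * ‖y‖ * Real.sin γ : ℝ))) * G (planeIso y)‖ ≤ C * ((1 + ‖y‖) ^ 2)⁻¹ := by
  rw [norm_mul, norm_exp_neg_I_mul, one_mul]
  exact (hC _).trans_eq (by rw [LinearIsometryEquiv.norm_map])

lemma integrable_spectrum_kernel (hw : IsStandardSinogram w) (hG : Continuous G)
    (hC : ∀ x, ‖G x‖ ≤ C * ((1 + ‖x‖) ^ 2)⁻¹) :
    Integrable (fun p : ℝ × ℂ => (‖p.2‖⁻¹ : ℝ) * (sheared w p.1 (arg p.2) : ℂ) *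
      (exp (-(I * (D * ‖p.2‖ * Real.sin p.1 : ℝ))) * G (planeIso p.2)))
      ((volume.restrict (Ioc 0 (2 * Real.pi))).prod volume) := by
  have hv := hw.integrable_sheared 0 (-Real.pi)
  rw [restrict_Ioc_pi_eq_Ioo, zero_add] at hv
  exact integrable_polar (v := fun γ θ => (sheared w γ θ : ℂ))
    (H := fun γ y => exp (-(I * (D * ‖y‖ * Real.sin γ : ℝ))) * G (planeIso y)) hv
    (Continuous.aestronglyMeasurable (Continuous.mul (by fun_prop)
      (hG.comp (planeIso.continuous.comp continuous_snd)))) (norm_wave_mul_le hC)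

lemma fanSpectrum_mul (y : ℂ) :
    fanSpectrum D w (planeIso y) * G (planeIso y) = ∫ γ in Ioc 0 (2 * Real.pi),
      (‖y‖⁻¹ : ℝ) * (sheared w γ (arg y) : ℂ) *
        (exp (-(I * (D * ‖y‖ * Real.sin γ : ℝ))) * G (planeIso y)) := by
  simp only [← mul_assoc]
  rw [integral_mul_const]
  simp only [mul_assoc ((‖y‖⁻¹ : ℝ) : ℂ)]
  rw [integral_const_mul, fanSpectrum, intervalIntegral.integral_of_le Real.two_pi_pos.le,
    LinearIsometryEquiv.norm_map, LinearIsometryEquiv.symm_apply_apply]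

lemma integrable_fanSpectrum_mul (hw : IsStandardSinogram w)
    (hG : Continuous G) (hC : ∀ x, ‖G x‖ ≤ C * ((1 + ‖x‖) ^ 2)⁻¹) :
    Integrable fun x => fanSpectrum D w x * G x := by
  rw [← planeIso.measurePreserving.integrable_comp_emb
    planeIso.toHomeomorph.toMeasurableEquiv.measurableEmbedding]
  simp only [Function.comp_def, fanSpectrum_mul]
  exact (integrable_spectrum_kernel hw hG hC).integral_prod_right

lemma integral_fanSpectrum_mul (hw : IsStandardSinogram w)
    (hG : Continuous G) (hC : ∀ x, ‖G x‖ ≤ C * ((1 + ‖x‖) ^ 2)⁻¹) :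
    ∫ x, fanSpectrum D w x * G x =
      ∫ γ in Ioc 0 (2 * Real.pi), ∫ θ in Ioo (-Real.pi) Real.pi, (sheared w γ θ : ℂ) *
        ∫ r in Ioi (0 : ℝ),
          exp (-(I * (D * r * Real.sin γ : ℝ))) * G (planeIso (r * exp (θ * I))) := by
  have hv := hw.integrable_sheared 0 (-Real.pi)
  rw [restrict_Ioc_pi_eq_Ioo, zero_add] at hv
  rw [← planeIso.measurePreserving.integral_comp
    planeIso.toHomeomorph.toMeasurableEquiv.measurableEmbedding]
  simp only [fanSpectrum_mul]
  rw [← integral_integral_swap (integrable_spectrum_kernel hw hG hC)]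
  rw [integral_polar (v := fun γ θ => (sheared w γ θ : ℂ))
    (H := fun γ y => exp (-(I * (D * ‖y‖ * Real.sin γ : ℝ))) * G (planeIso y)) hv
    (fun γ => Continuous.mul (by fun_prop) (hG.comp planeIso.continuous)) (norm_wave_mul_le hC)]
  refine integral_congr_ae (ae_of_all _ fun γ => ?_)
  refine integral_congr_ae (ae_of_all _ fun θ => ?_)
  simp only []
  congr 1
  refine setIntegral_congr_fun measurableSet_Ioi fun r hr => ?_
  have hr0 : (0 : ℝ) < r := hr
  simp only [norm_mul, norm_exp_ofReal_mul_I, norm_real, Real.norm_of_nonneg hr0.le, mul_one]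

end Pairing

/-! ### The Fourier slice theorem -/

section Slice

open scoped FourierTransform

lemma schwartz_quadratic_decay (φ : 𝓢(Plane, ℂ)) :
    ∃ C : ℝ, ∀ x, ‖φ x‖ ≤ C * ((1 + ‖x‖) ^ 2)⁻¹ := by
  obtain ⟨C₀, -, h₀⟩ := φ.decay 0 0
  obtain ⟨C₂, -, h₂⟩ := φ.decay 2 0
  refine ⟨2 * (C₀ + C₂), fun x => ?_⟩
  have h0 := h₀ x
  have h2 := h₂ x
  rw [norm_iteratedFDeriv_zero] at h0 h2
  rw [← div_eq_mul_inv, le_div_iff₀ (by positivity)]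
  -- `(1 + t)² ≤ 2 (1 + t²)` with `t = ‖x‖`
  nlinarith [norm_nonneg (φ x), mul_nonneg (norm_nonneg (φ x)) (sq_nonneg (‖x‖ - 1))]

/-- The Fourier transform of a Schwartz function, in the unitary normalization, is again a
Schwartz function. -/
lemma exists_schwartz_eq_fourierPlane (φ : 𝓢(Plane, ℂ)) :
    ∃ ψ : 𝓢(Plane, ℂ), ∀ x, fourierPlane φ x = ψ x := by
  have h2 : (2 * Real.pi)⁻¹ ≠ (0 : ℝ) := by positivity
  refine ⟨(1 / (2 * Real.pi) : ℂ) • SchwartzMap.compCLMOfContinuousLinearEquiv ℂ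
    (ContinuousLinearEquiv.smulLeft (R₁ := ℝ) (M₁ := Plane) (Units.mk0 _ h2)) (𝓕 φ), fun x => ?_⟩
  rw [smul_apply, SchwartzMap.compCLMOfContinuousLinearEquiv_apply,
    Function.comp_apply, SchwartzMap.fourier_coe, Real.fourier_eq', fourierPlane, smul_eq_mul]
  congr 1
  refine integral_congr_ae (ae_of_all _ fun v => ?_)
  simp only [ContinuousLinearEquiv.smulLeft_apply_apply, Units.smul_mk0, inner_smul_right,
    smul_eq_mul]
  congr 2
  have : (Real.pi : ℂ) ≠ 0 := by exact_mod_cast Real.pi_ne_zero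
  push_cast
  field_simp

lemma integrable_inv_one_add_abs_sq : Integrable fun t : ℝ => ((1 + |t|) ^ 2)⁻¹ := by
  refine (integrable_one_add_norm (E := ℝ) (μ := volume) (r := 2) (by simp)).congr
    (ae_of_all _ fun t => ?_)
  simp only [Real.norm_eq_abs]
  rw [Real.rpow_neg (by positivity)]
  norm_cast

/-- An integral over rays is a bounded measurable factor, when the integrand has quadratic decay. -/
lemma integrable_mul_rayIntegral {ν : Measure (ℝ × ℝ)} {Z : ℝ × ℝ → ℂ} (hZ : Integrable Z ν)
    {H : ℝ × ℝ → ℝ → ℂ} (hH : Continuous (Function.uncurry H)) {C : ℝ}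
    (hC : ∀ p, ∀ r > 0, ‖H p r‖ ≤ C * ((1 + r) ^ 2)⁻¹) :
    Integrable (fun p => Z p * ∫ r in Ioi (0 : ℝ), H p r) ν := by
  refine hZ.mul_bdd (c := ∫ r in Ioi (0 : ℝ), C * ((1 + r) ^ 2)⁻¹) ?_ (ae_of_all _ fun p => ?_)
  · exact hH.stronglyMeasurable.integral_prod_right.aestronglyMeasurable
  · refine norm_integral_le_of_norm_le (integrableOn_inv_one_add_sq.const_mul C) ?_
    filter_upwards [ae_restrict_mem measurableSet_Ioi] with r hr using hC p r hr

lemma integral_Ioi_neg_add_integral_Ioi {h : ℝ → ℂ} (hh : Integrable h) :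
    (∫ r in Ioi (0 : ℝ), h (-r)) + ∫ r in Ioi (0 : ℝ), h r = ∫ t, h t := by
  rw [integral_comp_neg_Ioi, neg_zero]
  exact intervalIntegral.integral_Iic_add_Ioi hh.integrableOn hh.integrableOn

variable {C : ℝ} {G : Plane → ℂ}

lemma norm_planeIso_rotate (θ : ℝ) (z : ℂ) : ‖planeIso (exp (θ * I) * z)‖ = ‖z‖ := by
  rw [LinearIsometryEquiv.norm_map, norm_mul, norm_exp_ofReal_mul_I, one_mul]

lemma decay_of_abs_le (hC : ∀ x, ‖G x‖ ≤ C * ((1 + ‖x‖) ^ 2)⁻¹) {x : Plane} {t : ℝ}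
    (ht : |t| ≤ ‖x‖) : ‖G x‖ ≤ C * ((1 + |t|) ^ 2)⁻¹ := by
  have hC0 : 0 ≤ C := by
    have := (norm_nonneg _).trans (hC 0)
    simpa using this
  refine (hC x).trans (mul_le_mul_of_nonneg_left ?_ hC0)
  gcongr

lemma integrable_line (hG : Continuous G) (hC : ∀ x, ‖G x‖ ≤ C * ((1 + ‖x‖) ^ 2)⁻¹)
    (θ s : ℝ) : Integrable fun t : ℝ => G (planeIso (exp (θ * I) * (s + t * I))) := by
  refine (integrable_inv_one_add_abs_sq.const_mul C).mono'
    (Continuous.aestronglyMeasurable (hG.comp (planeIso.continuous.comp (by fun_prop))))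
    (ae_of_all _ fun t => decay_of_abs_le hC ?_)
  rw [norm_planeIso_rotate]
  simpa using abs_im_le_norm (s + t * I : ℂ)

lemma integrable_wave_line (hG : Continuous G) (hC : ∀ x, ‖G x‖ ≤ C * ((1 + ‖x‖) ^ 2)⁻¹)
    (θ s b : ℝ) : Integrable fun a : ℝ =>
      exp (-(I * (s * a : ℝ))) * G (planeIso (exp (θ * I) * (a + b * I))) := by
  refine (integrable_inv_one_add_abs_sq.const_mul C).mono'
    (Continuous.aestronglyMeasurable (Continuous.mul (by fun_prop)
      (hG.comp (planeIso.continuous.comp (by fun_prop)))))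
    (ae_of_all _ fun a => ?_)
  rw [norm_mul, norm_exp_neg_I_mul, one_mul]
  refine decay_of_abs_le hC ?_
  rw [norm_planeIso_rotate]
  simpa using abs_re_le_norm (a + b * I : ℂ)

/-- The measure preserving coordinates `(b, a) ↦ a ξ_θ + b ξ_{θ + π/2}` on the plane. -/
def rotatedCoords (θ : ℝ) (p : ℝ × ℝ) : Plane := planeIso (exp (θ * I) * (p.2 + p.1 * I))

lemma rotatedCoords_eq_comp (θ : ℝ) : rotatedCoords θ =
    planeIso ∘ rotation (Circle.exp θ) ∘ Complex.measurableEquivRealProd.symm ∘ Prod.swap := by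
  funext p
  have : Complex.measurableEquivRealProd.symm p.swap = p.2 + p.1 * I := by
    apply Complex.ext <;> simp [Complex.measurableEquivRealProd_symm_apply]
  simp only [rotatedCoords, Function.comp_apply, rotation_apply, Circle.coe_exp, this]

lemma measurePreserving_rotatedCoords (θ : ℝ) :
    MeasurePreserving (rotatedCoords θ) (volume.prod volume) volume := by
  have h1 : MeasurePreserving (Prod.swap : ℝ × ℝ → ℝ × ℝ) (volume.prod volume)
    (volume.prod volume) := Measure.measurePreserving_swap
  have h2 := Complex.volume_preserving_equiv_real_prod.symm
  have h3 := (rotation (Circle.exp θ)).measurePreserving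
  have h4 := planeIso.measurePreserving
  rw [rotatedCoords_eq_comp]
  exact h4.comp (h3.comp (h2.comp h1))

lemma measurableEmbedding_rotatedCoords (θ : ℝ) : MeasurableEmbedding (rotatedCoords θ) := by
  rw [rotatedCoords_eq_comp]
  exact planeIso.toHomeomorph.toMeasurableEquiv.measurableEmbedding.comp
    ((rotation (Circle.exp θ)).toHomeomorph.toMeasurableEquiv.measurableEmbedding.comp
      (Complex.measurableEquivRealProd.symm.measurableEmbedding.comp
        MeasurableEquiv.prodComm.measurableEmbedding))

lemma continuous_rotatedCoords (θ : ℝ) : Continuous (rotatedCoords θ) :=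
  planeIso.continuous.comp (by fun_prop)

/-- The partial Fourier transform of `G` in the direction `ξ_θ`, as a function of the position in
the orthogonal direction. -/
def partialFourier (G : Plane → ℂ) (θ s b : ℝ) : ℂ :=
  ∫ a : ℝ, exp (-(I * (s * a : ℝ))) * G (rotatedCoords θ (b, a))

lemma continuous_partialFourier (hG : Continuous G)
    (hC : ∀ x, ‖G x‖ ≤ C * ((1 + ‖x‖) ^ 2)⁻¹) (θ s : ℝ) :
    Continuous (partialFourier G θ s) := by
  refine continuous_of_dominated (bound := fun a => C * ((1 + |a|) ^ 2)⁻¹)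
    (fun b => (integrable_wave_line hG hC θ s b).aestronglyMeasurable)
    (fun b => ae_of_all _ fun a => ?_)
    (integrable_inv_one_add_abs_sq.const_mul C) (ae_of_all _ fun a => ?_)
  · rw [norm_mul, norm_exp_neg_I_mul, one_mul]
    refine decay_of_abs_le hC ?_
    rw [rotatedCoords, norm_planeIso_rotate]
    simpa using abs_re_le_norm (a + b * I : ℂ)
  · exact continuous_const.mul (hG.comp ((continuous_rotatedCoords θ).comp (by fun_prop)))

lemma integrable_comp_rotatedCoords (hi : Integrable G) (θ s : ℝ) :
    Integrable (fun p : ℝ × ℝ => exp (-(I * (s * p.2 : ℝ))) * G (rotatedCoords θ p))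
      (volume.prod volume) := by
  refine (((measurePreserving_rotatedCoords θ).integrable_comp_of_integrable hi).norm).mono' ?_ ?_
  · refine AEStronglyMeasurable.mul (Continuous.aestronglyMeasurable (by fun_prop)) ?_
    exact ((measurePreserving_rotatedCoords θ).integrable_comp_of_integrable
      hi).aestronglyMeasurable
  · refine ae_of_all _ fun p => ?_
    rw [norm_mul, norm_exp_neg_I_mul, one_mul]
    rfl

lemma integrable_partialFourier (hi : Integrable G) (θ s : ℝ) :
    Integrable (partialFourier G θ s) :=
  (integrable_comp_rotatedCoords hi θ s).integral_prod_left

lemma fourierPlane_eq_partialFourier (hi : Integrable G) (θ s t : ℝ) :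
    fourierPlane G (planeIso (exp (θ * I) * (s + t * I))) =
      1 / (2 * Real.pi) * ∫ b : ℝ, exp (-(I * (t * b : ℝ))) * partialFourier G θ s b := by
  rw [fourierPlane]
  congr 1
  rw [← (measurePreserving_rotatedCoords θ).integral_comp (measurableEmbedding_rotatedCoords θ)]
  have hin : ∀ p : ℝ × ℝ, inner ℝ (rotatedCoords θ p) (planeIso (exp (θ * I) * (s + t * I))) =
      s * p.2 + t * p.1 := fun p => by
    rw [rotatedCoords, inner_planeIso]
    simp only [mul_re, mul_im, exp_ofReal_mul_I_re, exp_ofReal_mul_I_im, add_re, add_im, ofReal_re,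
      ofReal_im, I_re, I_im]
    linear_combination (s * p.2 + t * p.1) * Real.sin_sq_add_cos_sq θ
  have hk : ∀ p : ℝ × ℝ, exp (-(I * (inner ℝ (rotatedCoords θ p)
        (planeIso (exp (θ * I) * (s + t * I))) : ℝ))) * G (rotatedCoords θ p) =
      exp (-(I * (t * p.1 : ℝ))) *
        (exp (-(I * (s * p.2 : ℝ))) * G (rotatedCoords θ p)) := fun p => by
    rw [hin, ← mul_assoc, ← exp_add]
    congr 2
    push_cast
    ring
  simp only [hk]
  rw [integral_prod]
  · simp only [integral_const_mul, partialFourier]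
  · refine ((integrable_comp_rotatedCoords hi θ s).norm).mono' ?_ ?_
    · exact AEStronglyMeasurable.mul (Continuous.aestronglyMeasurable (by fun_prop))
        (integrable_comp_rotatedCoords hi θ s).aestronglyMeasurable
    · refine ae_of_all _ fun p => ?_
      rw [norm_mul, norm_exp_neg_I_mul, one_mul]

/-- The Fourier slice theorem: the integral of `φ̂` over the line `x · ξ_θ = s` is the
one-dimensional Fourier transform of `φ` along the line through the origin with direction `ξ_θ`.
It is Fourier inversion at the origin for the partial Fourier transform of `φ`. -/
lemma integral_line_fourierPlane (φ : 𝓢(Plane, ℂ)) (θ s : ℝ) :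
    ∫ t : ℝ, fourierPlane φ (planeIso (exp (θ * I) * (s + t * I))) =
      ∫ a : ℝ, exp (-(I * (s * a : ℝ))) * φ (planeIso (a * exp (θ * I))) := by
  obtain ⟨C, hC⟩ := schwartz_quadratic_decay φ
  have hcont := continuous_partialFourier φ.continuous hC θ s
  have hint := integrable_partialFourier φ.integrable θ s
  have hF : ∀ u : ℝ, 𝓕 (partialFourier φ θ s) u =
      2 * Real.pi * fourierPlane φ (planeIso (exp (θ * I) * (s + (2 * Real.pi * u : ℝ) * I))) := by
    intro u
    rw [fourierPlane_eq_partialFourier φ.integrable, Real.fourier_eq']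
    rw [← mul_assoc, mul_one_div_cancel (by simp), one_mul]
    refine integral_congr_ae (ae_of_all _ fun b => ?_)
    simp only [smul_eq_mul]
    congr 2
    simp
    ring
  obtain ⟨ψ, hψ⟩ := exists_schwartz_eq_fourierPlane φ
  obtain ⟨C', hC'⟩ := schwartz_quadratic_decay ψ
  have hl : Integrable fun t : ℝ => fourierPlane φ (planeIso (exp (θ * I) * (s + t * I))) := by
    simp only [hψ]
    exact integrable_line ψ.continuous hC' θ s
  have hFi : Integrable (𝓕 (partialFourier φ θ s)) := by
    rw [show 𝓕 (partialFourier φ θ s) = _ from funext hF]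
    exact (hl.comp_mul_left' Real.two_pi_pos.ne').const_mul _
  -- at the origin the inverse transform is the plain integral over all frequencies
  have hinv := congrFun (hcont.fourierInv_fourier_eq hint hFi) 0
  rw [Real.fourierInv_eq'] at hinv
  simp only [inner_zero_right, mul_zero, ofReal_zero, zero_mul, exp_zero, one_smul, hF] at hinv
  rw [integral_const_mul, Measure.integral_comp_mul_left
    (fun t : ℝ => fourierPlane φ (planeIso (exp (θ * I) * (s + t * I)))),
    abs_of_pos (by positivity), real_smul, ← mul_assoc] at hinv
  push_cast at hinv
  rw [mul_inv_cancel₀ (by simp), one_mul] at hinv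
  rw [hinv, partialFourier]
  simp only [rotatedCoords, ofReal_zero, zero_mul, add_zero]
  simp only [mul_comm]

end Slice

/-! ### The Jacobi–Anger expansion -/

/-- The coefficients of `exp (z t / 2) * exp (- z t⁻¹ / 2)` in powers of `t` and `t⁻¹`. -/
def genCoeff (z : ℝ) (p : ℕ × ℕ) : ℝ :=
  (z / 2) ^ p.1 / (p.1.factorial : ℝ) * ((-(z / 2)) ^ p.2 / (p.2.factorial : ℝ))

lemma summable_norm_genCoeff (z : ℝ) : Summable fun p => ‖genCoeff z p‖ := by
  have h1 : Summable fun j : ℕ => ‖(z / 2) ^ j / (j.factorial : ℝ)‖ :=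
    (Real.summable_pow_div_factorial (z / 2)).norm
  have h2 : Summable fun j : ℕ => ‖(-(z / 2)) ^ j / (j.factorial : ℝ)‖ :=
    (Real.summable_pow_div_factorial (-(z / 2))).norm
  simp only [genCoeff]
  exact Summable.mul_norm (f := fun j : ℕ => (z / 2) ^ j / (j.factorial : ℝ))
    (g := fun j : ℕ => (-(z / 2)) ^ j / (j.factorial : ℝ)) h1 h2

/-- Pairs `(j, k)` of natural numbers, parametrized by the difference `j - k` and the minimum of
`j` and `k`. -/
def diffEquiv : ℤ × ℕ ≃ ℕ × ℕ where
  toFun q := (q.2 + q.1.toNat, q.2 + (-q.1).toNat)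
  invFun p := ((p.1 : ℤ) - p.2, min p.1 p.2)
  left_inv q := Prod.ext (by simp) (by simp; omega)
  right_inv p := Prod.ext (by simp; omega) (by simp; omega)

lemma diffEquiv_sub (q : ℤ × ℕ) :
    (((diffEquiv q).1 : ℤ) - (diffEquiv q).2) = q.1 := by
  simp only [diffEquiv, Equiv.coe_fn_mk]
  push_cast
  omega

/-- The terms whose exponents differ by `n` add up to `J_n`. -/
lemma hasSum_genCoeff_natCast (z : ℝ) (n : ℕ) :
    HasSum (fun m : ℕ => genCoeff z (diffEquiv ((n : ℤ), m))) (besselJ n z) := by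
  have hs : Summable fun m : ℕ => genCoeff z (diffEquiv ((n : ℤ), m)) :=
    Summable.prod_factor (f := fun q => genCoeff z (diffEquiv q))
      (diffEquiv.summable_iff.2 (summable_norm_genCoeff z).of_norm) _
  refine hs.hasSum_iff.2 ?_
  rw [besselJ]
  refine tsum_congr fun m => ?_
  have : (-(z / 2)) ^ m = (-1) ^ m * (z / 2) ^ m := neg_pow _ _
  simp only [genCoeff, diffEquiv, Equiv.coe_fn_mk, Int.toNat_natCast, Int.toNat_neg_natCast,
    add_zero, this]
  field_simp
  ring

/-- The terms whose exponents differ by `-n` add up to `J_{-n} = (-1)^n J_n`. -/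
lemma hasSum_genCoeff_neg_natCast (z : ℝ) (n : ℕ) :
    HasSum (fun m : ℕ => genCoeff z (diffEquiv (-(n : ℤ), m))) ((-1) ^ n * besselJ n z) := by
  refine ((hasSum_genCoeff_natCast z n).mul_left ((-1) ^ n)).congr_fun fun m => ?_
  have h1 : (-(z / 2)) ^ m = (-1) ^ m * (z / 2) ^ m := neg_pow _ _
  have h2 : (-(z / 2)) ^ (m + n) = (-1) ^ (m + n) * (z / 2) ^ (m + n) := neg_pow _ _
  simp only [genCoeff, diffEquiv, Equiv.coe_fn_mk, Int.toNat_natCast, Int.toNat_neg_natCast,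
    add_zero, neg_neg, h1, h2]
  ring

/-- The generating function of the Bessel functions at `t = e^{-iγ}`. -/
lemma hasSum_genCoeff_mul_exp (z γ : ℝ) :
    HasSum (fun p : ℕ × ℕ => (genCoeff z p : ℂ) * exp (-(I * ((p.1 : ℤ) - (p.2 : ℤ) : ℤ) * γ)))
      (exp (-(I * (z * Real.sin γ : ℝ)))) := by
  have h1 := NormedSpace.expSeries_div_hasSum_exp (𝔸 := ℂ) (z / 2 * exp (-(I * γ)))
  have h2 := NormedSpace.expSeries_div_hasSum_exp (𝔸 := ℂ) (-(z / 2) * exp (I * γ))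
  have hs := summable_mul_of_summable_norm
    (NormedSpace.norm_expSeries_div_summable (z / 2 * exp (-(I * γ))))
    (NormedSpace.norm_expSeries_div_summable (-(z / 2) * exp (I * γ)))
  have h := h1.mul h2 hs
  rw [← Complex.exp_eq_exp_ℂ, ← exp_add] at h
  have hsum : z / 2 * exp (-(I * γ)) + -(z / 2) * exp (I * γ) = -(I * (z * Real.sin γ : ℝ)) := by
    have e1 : exp (I * γ) = Complex.cos γ + Complex.sin γ * I := by rw [mul_comm, exp_mul_I]
    have e2 : exp (-(I * γ)) = Complex.cos γ - Complex.sin γ * I := by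
      rw [show -(I * (γ : ℂ)) = (-γ) * I by ring, exp_mul_I, Complex.cos_neg, Complex.sin_neg]
      ring
    rw [e1, e2]
    push_cast
    ring
  rw [hsum] at h
  refine h.congr_fun fun p => ?_
  have he : exp (-(I * ((p.1 : ℤ) - (p.2 : ℤ) : ℤ) * γ)) =
      exp (-(I * γ)) ^ p.1 * exp (I * γ) ^ p.2 := by
    rw [← exp_nat_mul, ← exp_nat_mul, ← exp_add]
    congr 1
    push_cast
    ring
  rw [he, genCoeff, mul_pow, mul_pow]
  push_cast
  ring

lemma hasSum_integral_wave {μ : Measure ℝ} {f : ℝ → ℂ} (hf : Integrable f μ) (z : ℝ) :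
    HasSum (fun p : ℕ × ℕ => (genCoeff z p : ℂ) *
      ∫ γ, f γ * exp (-(I * ((p.1 : ℤ) - (p.2 : ℤ) : ℤ) * γ)) ∂μ)
      (∫ γ, f γ * exp (-(I * (z * Real.sin γ : ℝ))) ∂μ) := by
  have hn : ∀ (n : ℤ) (γ : ℝ), ‖exp (-(I * n * γ))‖ = 1 := fun n γ => by
    have := norm_exp_neg_I_mul (n * γ)
    push_cast at this
    rwa [← mul_assoc] at this
  have hi : ∀ n : ℤ, Integrable (fun γ => f γ * exp (-(I * n * γ))) μ := fun n =>
    hf.mul_bdd (c := 1) (Continuous.aestronglyMeasurable (by fun_prop))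
      (ae_of_all _ fun γ => (hn n γ).le)
  have h := hasSum_integral_of_summable_integral_norm (μ := μ)
    (F := fun (p : ℕ × ℕ) γ => (genCoeff z p : ℂ) *
      (f γ * exp (-(I * ((p.1 : ℤ) - (p.2 : ℤ) : ℤ) * γ))))
    (fun p => (hi _).const_mul _) ?_
  · have ht : ∀ γ, ∑' p : ℕ × ℕ, (genCoeff z p : ℂ) *
        (f γ * exp (-(I * ((p.1 : ℤ) - (p.2 : ℤ) : ℤ) * γ))) =
        f γ * exp (-(I * (z * Real.sin γ : ℝ))) := fun γ => by
      rw [← ((hasSum_genCoeff_mul_exp z γ).mul_left (f γ)).tsum_eq]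
      exact tsum_congr fun p => by ring
    simp only [integral_const_mul, ht] at h
    exact h
  · simp only [norm_mul, hn, mul_one, integral_const_mul, norm_real]
    exact (summable_norm_genCoeff z).mul_right _

/-- The Jacobi–Anger expansion, integrated against a real function. -/
lemma hasSum_besselJ {μ : Measure ℝ} {f : ℝ → ℝ} (hf : Integrable f μ) (z : ℝ) :
    HasSum (fun n : ℕ => (if n = 0 then ∫ γ, (f γ : ℂ) * exp (-(I * n * γ)) ∂μ else
      (∫ γ, (f γ : ℂ) * exp (-(I * n * γ)) ∂μ) +
        (-1) ^ n * (starRingEnd ℂ) (∫ γ, (f γ : ℂ) * exp (-(I * n * γ)) ∂μ)) * (besselJ n z : ℂ))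
      (∫ γ, (f γ : ℂ) * exp (-(I * (z * Real.sin γ : ℝ))) ∂μ) := by
  set c : ℤ → ℂ := fun n => ∫ γ, (f γ : ℂ) * exp (-(I * n * γ)) ∂μ with hc
  have hneg : ∀ n : ℤ, c (-n) = (starRingEnd ℂ) (c n) := fun n => by
    simp only [hc]
    rw [← integral_conj]
    refine integral_congr_ae (ae_of_all _ fun γ => ?_)
    simp only [map_mul, conj_ofReal, ← exp_conj, map_neg, conj_I, map_intCast]
    congr 2
    push_cast
    ring
  have h := diffEquiv.hasSum_iff.2 (hasSum_integral_wave hf.ofReal z)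
  have h1 : (fun p : ℕ × ℕ => (genCoeff z p : ℂ) *
      ∫ γ, (f γ : ℂ) * exp (-(I * ((p.1 : ℤ) - (p.2 : ℤ) : ℤ) * γ)) ∂μ) ∘ diffEquiv =
      fun q => (genCoeff z (diffEquiv q) : ℂ) * c q.1 := by
    funext q
    simp only [Function.comp_apply, diffEquiv_sub, hc]
  have h2 : HasSum (fun q => (genCoeff z (diffEquiv q) : ℂ) * c q.1)
      (∫ γ, (f γ : ℂ) * exp (-(I * (z * Real.sin γ : ℝ))) ∂μ) := h1 ▸ h
  have h3 := h2.prod_fiberwise (g := fun n => ∑' m, (genCoeff z (diffEquiv (n, m)) : ℂ) * c n)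
    fun n => (h2.summable.prod_factor n).hasSum
  have hp : ∀ n : ℕ, ∑' m, (genCoeff z (diffEquiv ((n : ℤ), m)) : ℂ) * c n =
      besselJ n z * c n := fun n =>
    ((Complex.hasSum_ofReal.2 (hasSum_genCoeff_natCast z n)).mul_right _).tsum_eq
  have hm : ∀ n : ℕ, ∑' m, (genCoeff z (diffEquiv (-(n : ℤ), m)) : ℂ) * c (-n) =
      (-1) ^ n * besselJ n z * c (-n) := fun n => by
    have := ((Complex.hasSum_ofReal.2 (hasSum_genCoeff_neg_natCast z n)).mul_right (c (-n))).tsum_eq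
    rw [this]
    push_cast
    rfl
  -- folding `ℤ` onto `ℕ` counts the term `n = 0` twice
  have h4 := h3.nat_add_neg.sub (hasSum_ite_eq 0 (besselJ 0 z * c 0 : ℂ))
  have h0 := hp 0
  simp only [Nat.cast_zero] at h0
  rw [h0, add_sub_cancel_right] at h4
  refine h4.congr_fun fun n => ?_
  rw [hp, hm, hneg]
  have hcn : ∫ γ, (f γ : ℂ) * exp (-(I * n * γ)) ∂μ = c n := by simp only [hc, Int.cast_natCast]
  rw [hcn]
  split_ifs with hn
  · subst hn
    have : (starRingEnd ℂ) (c 0) = c 0 := by rw [← hneg, neg_zero]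
    simp only [Nat.cast_zero, this, pow_zero]
    ring
  · ring

lemma hasSum_coeffB_mul_besselJ (w : ℝ → ℝ → ℝ) (θ z : ℝ) :
    HasSum (fun n : ℕ => coeffB w n θ * (besselJ n z : ℂ))
      (∫ γ in (0 : ℝ)..(2 * Real.pi),
        (sheared w γ θ : ℂ) * exp (-(I * (z * Real.sin γ : ℝ)))) := by
  have hle := Real.two_pi_pos.le
  by_cases hi : IntegrableOn (fun γ => sheared w γ θ) (Ioc 0 (2 * Real.pi))
  · rw [intervalIntegral.integral_of_le hle]
    refine (hasSum_besselJ hi z).congr_fun fun n => ?_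
    · have hcn : 2 * Real.pi * coeffC w n θ =
          ∫ γ in Ioc 0 (2 * Real.pi), (sheared w γ θ : ℂ) * exp (-(I * n * γ)) := by
        rw [coeffC, ← mul_assoc, mul_one_div_cancel (by simp), one_mul,
          intervalIntegral.integral_of_le hle]
      rw [← hcn, coeffB]
      split_ifs with h0
      · rw [h0]
      · simp only [map_mul, map_ofNat, conj_ofReal]
        ring
  · -- both sides vanish, since a unimodular factor does not restore integrability
    have key : ∀ u : ℝ → ℝ, Continuous u →
        ∫ γ in (0 : ℝ)..(2 * Real.pi), (sheared w γ θ : ℂ) * exp (-(I * u γ)) = 0 := by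
      intro u hu
      rw [intervalIntegral.integral_of_le hle]
      refine integral_undef fun h => hi ?_
      have h' := h.mul_bdd (c := 1) (g := fun γ => exp (-(I * (-u γ : ℝ))))
        (Continuous.aestronglyMeasurable (by fun_prop))
        (ae_of_all _ fun γ => (norm_exp_neg_I_mul _).le)
      refine h'.re.congr (ae_of_all _ fun γ => ?_)
      simp only [mul_assoc, ← exp_add]
      simp
    have hc : ∀ n : ℕ, coeffC w n θ = 0 := fun n => by
      have := key (fun γ => n * γ) (by fun_prop)
      push_cast at this
      simp only [← mul_assoc] at this
      rw [coeffC, this, mul_zero]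
    have hb : ∀ n : ℕ, coeffB w n θ = 0 := fun n => by simp [coeffB, hc]
    simp only [key (fun γ => z * Real.sin γ) (by fun_prop), hb, zero_mul]
    exact hasSum_zero

/-! ### Symmetrization -/

section Square

variable {D C : ℝ} {w : ℝ → ℝ → ℝ}

lemma setIntegral_period_shift {h : ℝ → ℂ} (hh : Function.Periodic h (2 * Real.pi)) (a b c : ℝ) :
    ∫ t in Ioc a (a + 2 * Real.pi), h t = ∫ t in Ioc b (b + 2 * Real.pi), h (t + c) := by
  have hp := Real.two_pi_pos
  rw [← intervalIntegral.integral_of_le (by linarith),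
    ← intervalIntegral.integral_of_le (by linarith), intervalIntegral.integral_comp_add_right,
    add_right_comm]
  exact hh.intervalIntegral_add_eq a (b + c)

/-- The measure on a fundamental square of the torus. -/
def squareMeasure : Measure (ℝ × ℝ) :=
  (volume.restrict (Ioc (-Real.pi) (-Real.pi + 2 * Real.pi))).prod
    (volume.restrict (Ioc (-Real.pi) (-Real.pi + 2 * Real.pi)))

/-- The integral over the torus is invariant under `(γ, θ) ↦ (γ + π, θ + π)`. -/
lemma integral_square_add_pi {f : ℝ × ℝ → ℂ} (hf : Integrable f squareMeasure)
    (hf' : Integrable (fun p => f (p + (Real.pi, Real.pi))) squareMeasure)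
    (h1 : ∀ γ θ, f (γ + 2 * Real.pi, θ) = f (γ, θ))
    (h2 : ∀ γ θ, f (γ, θ + 2 * Real.pi) = f (γ, θ)) :
    ∫ p, f (p + (Real.pi, Real.pi)) ∂squareMeasure = ∫ p, f p ∂squareMeasure := by
  rw [squareMeasure] at *
  rw [integral_prod _ hf, integral_prod _ hf']
  have hper : Function.Periodic (fun γ => ∫ θ in Ioc (-Real.pi) (-Real.pi + 2 * Real.pi),
      f (γ, θ)) (2 * Real.pi) := fun γ => by simp only [h1]
  rw [setIntegral_period_shift hper (-Real.pi) (-Real.pi) Real.pi]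
  refine integral_congr_ae (ae_of_all _ fun γ => ?_)
  simp only []
  rw [setIntegral_period_shift (h := fun θ => f (γ + Real.pi, θ)) (fun θ => h2 _ θ)
    (-Real.pi) (-Real.pi) Real.pi]
  rfl

/-- Two weights with the same symmetrization under `(γ, θ) ↦ (γ + π, θ + π)` have the same integral
against the sheared sinogram, which is invariant under that map. -/
lemma integral_sheared_congr (hw : IsStandardSinogram w) {A B : ℝ × ℝ → ℂ}
    (hA1 : ∀ γ θ, A (γ + 2 * Real.pi, θ) = A (γ, θ))
    (hA2 : ∀ γ θ, A (γ, θ + 2 * Real.pi) = A (γ, θ))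
    (hB1 : ∀ γ θ, B (γ + 2 * Real.pi, θ) = B (γ, θ))
    (hB2 : ∀ γ θ, B (γ, θ + 2 * Real.pi) = B (γ, θ))
    (hA : Integrable (fun p => (sheared w p.1 p.2 : ℂ) * A p) squareMeasure)
    (hA' : Integrable (fun p => (sheared w p.1 p.2 : ℂ) * A (p + (Real.pi, Real.pi))) squareMeasure)
    (hB : Integrable (fun p => (sheared w p.1 p.2 : ℂ) * B p) squareMeasure)
    (hB' : Integrable (fun p => (sheared w p.1 p.2 : ℂ) * B (p + (Real.pi, Real.pi))) squareMeasure)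
    (hAB : ∀ p, A p + A (p + (Real.pi, Real.pi)) = B p + B (p + (Real.pi, Real.pi))) :
    ∫ p, (sheared w p.1 p.2 : ℂ) * A p ∂squareMeasure =
      ∫ p, (sheared w p.1 p.2 : ℂ) * B p ∂squareMeasure := by
  have key : ∀ A : ℝ × ℝ → ℂ, (∀ γ θ, A (γ + 2 * Real.pi, θ) = A (γ, θ)) →
      (∀ γ θ, A (γ, θ + 2 * Real.pi) = A (γ, θ)) →
      Integrable (fun p => (sheared w p.1 p.2 : ℂ) * A p) squareMeasure →
      Integrable (fun p => (sheared w p.1 p.2 : ℂ) * A (p + (Real.pi, Real.pi))) squareMeasure →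
      2 * ∫ p, (sheared w p.1 p.2 : ℂ) * A p ∂squareMeasure =
        ∫ p, (sheared w p.1 p.2 : ℂ) * (A p + A (p + (Real.pi, Real.pi))) ∂squareMeasure := by
    intro A h1 h2 hA hA'
    have hz : ∀ p : ℝ × ℝ, sheared w (p + (Real.pi, Real.pi)).1 (p + (Real.pi, Real.pi)).2 =
        sheared w p.1 p.2 := fun p => hw.sheared_add_pi_add_pi _ _
    have h := integral_square_add_pi hA (by simpa only [hz] using hA')
      (fun γ θ => by simp only [hw.sheared_add_two_pi, h1])
      (fun γ θ => by simp only [hw.sheared_periodic_snd γ θ, h2])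
    simp only [hz] at h
    simp only [mul_add]
    rw [integral_add hA hA', h, two_mul]
  have h := key A hA1 hA2 hA hA'
  simp only [hAB] at h
  rw [← key B hB1 hB2 hB hB'] at h
  exact mul_left_cancel₀ two_ne_zero h

/-- The integral of `G` over the ray from the source on the line `x · ξ_θ = D sin γ`. -/
def rayIntegral (D : ℝ) (G : Plane → ℂ) (p : ℝ × ℝ) : ℂ :=
  ∫ r in Ioi (0 : ℝ), G (planeIso (exp (p.2 * I) *
    ((D * Real.sin p.1 : ℝ) + (D * Real.cos p.1 - r : ℝ) * I)))

/-- The integral of `φ` over the ray from the origin with direction `ξ_θ`, against the plane wave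
`e^{-i D σ sin γ}`. -/
def waveIntegral (D : ℝ) (φ : Plane → ℂ) (p : ℝ × ℝ) : ℂ :=
  ∫ r in Ioi (0 : ℝ), exp (-(I * (D * r * Real.sin p.1 : ℝ))) * φ (planeIso (r * exp (p.2 * I)))

/-- The point at distance `r` from the source on the ray with fan angle `γ` lies on the line
`x · ξ_θ = D sin γ`, where `θ = β + γ`. -/
lemma fan_point (D γ θ r : ℝ) : I * exp ((θ - γ : ℝ) * I) * (D - r * exp (γ * I)) =
    exp (θ * I) * ((D * Real.sin γ : ℝ) + (D * Real.cos γ - r : ℝ) * I) := by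
  have h1 : exp ((θ - γ : ℝ) * I) = exp (θ * I) * (Complex.cos γ - Complex.sin γ * I) := by
    rw [show ((θ - γ : ℝ) : ℂ) * I = θ * I + (-γ) * I by push_cast; ring, exp_add, exp_mul_I (-γ),
      Complex.cos_neg, Complex.sin_neg]
    ring
  rw [h1, exp_mul_I γ]
  push_cast
  have h2 := Complex.sin_sq_add_cos_sq γ
  linear_combination (-exp (θ * I) * I * r) * h2 +
    (-exp (θ * I) * Complex.sin γ * D + exp (θ * I) * I * r * Complex.sin γ ^ 2) * I_sq

lemma exp_add_pi_mul_I (θ : ℝ) : exp ((θ + Real.pi : ℝ) * I) = -exp (θ * I) := by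
  rw [ofReal_add, add_mul, exp_add, exp_pi_mul_I, mul_neg_one]

lemma exp_add_two_pi_mul_I (θ : ℝ) : exp ((θ + 2 * Real.pi : ℝ) * I) = exp (θ * I) := by
  rw [two_mul, ← add_assoc, exp_add_pi_mul_I, exp_add_pi_mul_I, neg_neg]

lemma rayIntegral_add {G : Plane → ℂ} (hG : Continuous G)
    (hC : ∀ x, ‖G x‖ ≤ C * ((1 + ‖x‖) ^ 2)⁻¹) (p : ℝ × ℝ) :
    rayIntegral D G p + rayIntegral D G (p + (Real.pi, Real.pi)) =
      ∫ t : ℝ, G (planeIso (exp (p.2 * I) * ((D * Real.sin p.1 : ℝ) + t * I))) := by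
  have hl := integrable_line hG hC p.2 (D * Real.sin p.1)
  rw [← integral_add_right_eq_self _ (D * Real.cos p.1),
    ← integral_Ioi_neg_add_integral_Ioi (hl.comp_add_right (D * Real.cos p.1))]
  congr 1
  · refine integral_congr_ae (ae_of_all _ fun r => ?_)
    simp only []
    rw [neg_add_eq_sub]
  · refine integral_congr_ae (ae_of_all _ fun r => ?_)
    simp only [Prod.fst_add, Prod.snd_add, exp_add_pi_mul_I, Real.sin_add_pi, Real.cos_add_pi]
    congr 2
    push_cast
    ring

lemma waveIntegral_add {φ : Plane → ℂ} (hφ : Continuous φ)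
    (hC : ∀ x, ‖φ x‖ ≤ C * ((1 + ‖x‖) ^ 2)⁻¹) (p : ℝ × ℝ) :
    waveIntegral D φ p + waveIntegral D φ (p + (Real.pi, Real.pi)) =
      ∫ a : ℝ, exp (-(I * (D * Real.sin p.1 * a : ℝ))) * φ (planeIso (a * exp (p.2 * I))) := by
  have hl := integrable_wave_line hφ hC p.2 (D * Real.sin p.1) 0
  simp only [ofReal_zero, zero_mul, add_zero, mul_comm (exp (p.2 * I))] at hl
  rw [← integral_Ioi_neg_add_integral_Ioi hl, add_comm]
  congr 1
  · refine integral_congr_ae (ae_of_all _ fun r => ?_)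
    simp only [Prod.fst_add, Prod.snd_add, exp_add_pi_mul_I, Real.sin_add_pi]
    congr 3
    · push_cast; ring
    · push_cast; ring
  · refine integral_congr_ae (ae_of_all _ fun r => ?_)
    simp only []
    congr 3
    push_cast
    ring

lemma integrable_sheared_mul_rayIntegral (hD : 0 < D) (hw : IsStandardSinogram w) {G : Plane → ℂ}
    (hG : Continuous G) (hC : ∀ x, ‖G x‖ ≤ C * ((1 + ‖x‖) ^ 2)⁻¹) (q : ℝ × ℝ) :
    Integrable (fun p => (sheared w p.1 p.2 : ℂ) * rayIntegral D G (p + q)) squareMeasure := by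
  refine integrable_mul_rayIntegral (C := C * (1 + D) ^ 2) (hw.integrable_sheared _ _)
    (H := fun p r => G (planeIso (exp ((p + q).2 * I) *
    ((D * Real.sin (p + q).1 : ℝ) + (D * Real.cos (p + q).1 - r : ℝ) * I)))) ?_ fun p r hr => ?_
  · exact hG.comp (planeIso.continuous.comp (by fun_prop))
  · rw [← fan_point]
    refine (norm_comp_fan_le hD hC _ _).trans_eq ?_
    rw [norm_mul, norm_exp_ofReal_mul_I, mul_one, norm_real, Real.norm_of_nonneg (le_of_lt hr)]

lemma integrable_sheared_mul_waveIntegral (hw : IsStandardSinogram w) {φ : Plane → ℂ}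
    (hφ : Continuous φ) (hC : ∀ x, ‖φ x‖ ≤ C * ((1 + ‖x‖) ^ 2)⁻¹) (q : ℝ × ℝ) :
    Integrable (fun p => (sheared w p.1 p.2 : ℂ) * waveIntegral D φ (p + q)) squareMeasure := by
  refine integrable_mul_rayIntegral (C := C) (hw.integrable_sheared _ _)
    (H := fun p r => exp (-(I * (D * r * Real.sin (p + q).1 : ℝ))) *
      φ (planeIso (r * exp ((p + q).2 * I)))) ?_ fun p r hr => ?_
  · exact Continuous.mul (by fun_prop) (hφ.comp (planeIso.continuous.comp (by fun_prop)))
  · rw [norm_mul, norm_exp_neg_I_mul, one_mul]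
    refine (hC _).trans_eq ?_
    rw [LinearIsometryEquiv.norm_map, norm_mul, norm_exp_ofReal_mul_I, mul_one, norm_real,
      Real.norm_of_nonneg (le_of_lt hr)]

/-! ### The Fourier transform of the backprojection -/

lemma rayIntegral_add_two_pi_fst (G : Plane → ℂ) (γ θ : ℝ) :
    rayIntegral D G (γ + 2 * Real.pi, θ) = rayIntegral D G (γ, θ) := by
  simp only [rayIntegral, Real.sin_add_two_pi, Real.cos_add_two_pi]

lemma rayIntegral_add_two_pi_snd (G : Plane → ℂ) (γ θ : ℝ) :
    rayIntegral D G (γ, θ + 2 * Real.pi) = rayIntegral D G (γ, θ) := by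
  simp only [rayIntegral, exp_add_two_pi_mul_I]

lemma waveIntegral_add_two_pi_fst (φ : Plane → ℂ) (γ θ : ℝ) :
    waveIntegral D φ (γ + 2 * Real.pi, θ) = waveIntegral D φ (γ, θ) := by
  simp only [waveIntegral, Real.sin_add_two_pi]

lemma waveIntegral_add_two_pi_snd (φ : Plane → ℂ) (γ θ : ℝ) :
    waveIntegral D φ (γ, θ + 2 * Real.pi) = waveIntegral D φ (γ, θ) := by
  simp only [waveIntegral, exp_add_two_pi_mul_I]

lemma integral_fanBackprojection_mul_eq_square (hD : 0 < D) (hw : IsStandardSinogram w)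
    {G : Plane → ℂ} (hG : Continuous G) (hC : ∀ x, ‖G x‖ ≤ C * ((1 + ‖x‖) ^ 2)⁻¹) :
    ∫ x, (fanBackprojection D w x : ℂ) * G x =
      ∫ p, (sheared w p.1 p.2 : ℂ) * rayIntegral D G p ∂squareMeasure := by
  have hray : ∀ β γ : ℝ,
      ∫ r in Ioi (0 : ℝ), G (planeIso (I * exp (β * I) * (D - r * exp (γ * I)))) =
        rayIntegral D G (γ, β + γ) := fun β γ => by
    simp only [rayIntegral, ← fan_point, add_sub_cancel_right]
  have hi : Integrable (fun p : ℝ × ℝ => (w p.2 p.1 : ℂ) * rayIntegral D G (p.2, p.1 + p.2))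
      ((volume.restrict (Ioc 0 (2 * Real.pi))).prod
        (volume.restrict (Ioc (-Real.pi) (-Real.pi + 2 * Real.pi)))) := by
    simp only [← hray]
    refine integrable_mul_rayIntegral (C := C * (1 + D) ^ 2) (hw.integrable_swap _)
      (H := fun p r => G (planeIso (I * exp (p.1 * I) * (D - r * exp (p.2 * I)))))
      (hG.comp (planeIso.continuous.comp (by fun_prop))) fun p r hr => ?_
    refine (norm_comp_fan_le hD hC _ _).trans_eq ?_
    rw [norm_mul, norm_exp_ofReal_mul_I, mul_one, norm_real, Real.norm_of_nonneg (le_of_lt hr)]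
  have hq : Integrable (fun p => (sheared w p.1 p.2 : ℂ) * rayIntegral D G p) squareMeasure := by
    simpa only [add_zero] using integrable_sheared_mul_rayIntegral hD hw hG hC 0
  rw [integral_fanBackprojection_mul hD hw hG hC, squareMeasure, integral_prod _ hq,
    ← restrict_Ioc_pi_eq_Ioo]
  simp only [hray]
  rw [integral_integral_swap hi]
  refine integral_congr_ae (ae_of_all _ fun γ => ?_)
  have hper : Function.Periodic (fun β => (w γ β : ℂ) * rayIntegral D G (γ, β + γ))
      (2 * Real.pi) := fun β => by
    simp only [hw.periodic_snd, add_right_comm β _ γ, rayIntegral_add_two_pi_snd]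
  have := setIntegral_period_shift hper 0 (-Real.pi) (-γ)
  rw [zero_add] at this
  simp only [this]
  refine integral_congr_ae (ae_of_all _ fun θ => ?_)
  simp only [neg_add_cancel_right, sheared, sub_eq_add_neg]

lemma integral_fanSpectrum_mul_eq_square (hw : IsStandardSinogram w)
    {φ : Plane → ℂ} (hφ : Continuous φ) (hC : ∀ x, ‖φ x‖ ≤ C * ((1 + ‖x‖) ^ 2)⁻¹) :
    ∫ x, fanSpectrum D w x * φ x =
      ∫ p, (sheared w p.1 p.2 : ℂ) * waveIntegral D φ p ∂squareMeasure := by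
  have hq : Integrable (fun p => (sheared w p.1 p.2 : ℂ) * waveIntegral D φ p) squareMeasure := by
    simpa only [add_zero] using integrable_sheared_mul_waveIntegral hw hφ hC 0
  rw [integral_fanSpectrum_mul hw hφ hC, squareMeasure, integral_prod _ hq,
    ← restrict_Ioc_pi_eq_Ioo]
  have hper : Function.Periodic (fun γ => ∫ θ in Ioc (-Real.pi) (-Real.pi + 2 * Real.pi),
      (sheared w γ θ : ℂ) * waveIntegral D φ (γ, θ)) (2 * Real.pi) := fun γ => by
    simp only [hw.sheared_add_two_pi, waveIntegral_add_two_pi_fst]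
  have := setIntegral_period_shift hper 0 (-Real.pi) 0
  simp only [zero_add, add_zero] at this
  exact this

/-- `fanSpectrum` is the distributional Fourier transform of the backprojection. -/
lemma integral_fanBackprojection_mul_fourierPlane (hD : 0 < D) (hw : IsStandardSinogram w)
    (φ : 𝓢(Plane, ℂ)) :
    ∫ x, (fanBackprojection D w x : ℂ) * fourierPlane φ x = ∫ x, fanSpectrum D w x * φ x := by
  obtain ⟨ψ, hψ⟩ := exists_schwartz_eq_fourierPlane φ
  obtain ⟨C, hC⟩ := schwartz_quadratic_decay φ
  obtain ⟨C', hC'⟩ := schwartz_quadratic_decay ψ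
  have hψ' : fourierPlane φ = ψ := funext hψ
  rw [hψ', integral_fanBackprojection_mul_eq_square hD hw ψ.continuous hC',
    integral_fanSpectrum_mul_eq_square hw φ.continuous hC]
  refine integral_sheared_congr hw (rayIntegral_add_two_pi_fst _) (rayIntegral_add_two_pi_snd _)
    (waveIntegral_add_two_pi_fst _) (waveIntegral_add_two_pi_snd _) ?_
    (integrable_sheared_mul_rayIntegral hD hw ψ.continuous hC' _) ?_
    (integrable_sheared_mul_waveIntegral hw φ.continuous hC _) fun p => ?_
  · simpa only [add_zero] using integrable_sheared_mul_rayIntegral hD hw ψ.continuous hC' 0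
  · simpa only [add_zero] using integrable_sheared_mul_waveIntegral hw φ.continuous hC 0
  · rw [rayIntegral_add ψ.continuous hC', waveIntegral_add φ.continuous hC, ← hψ',
      integral_line_fourierPlane]

/-- Temperedness with the exponent `2`. -/
lemma isTempered_of_integrable_mul {g : Plane → ℂ}
    (hg : Integrable fun x => g x * ((((1 + ‖x‖) ^ 2)⁻¹ : ℝ) : ℂ)) : IsTempered g := by
  refine ⟨2, hg.congr (ae_of_all _ fun x => ?_)⟩
  simp only []
  rw [div_eq_mul_inv]
  push_cast
  rfl

lemma continuous_quadratic_weight :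
    Continuous fun x : Plane => ((((1 + ‖x‖) ^ 2)⁻¹ : ℝ) : ℂ) := by
  refine continuous_ofReal.comp (Continuous.inv₀ (by fun_prop) fun x => ?_)
  positivity

lemma norm_quadratic_weight_le (x : Plane) :
    ‖((((1 + ‖x‖) ^ 2)⁻¹ : ℝ) : ℂ)‖ ≤ 1 * ((1 + ‖x‖) ^ 2)⁻¹ := by
  rw [norm_real, one_mul, Real.norm_of_nonneg (by positivity)]

theorem hasFourierTransform_fanBackprojection (hD : 0 < D) (hw : IsStandardSinogram w) :
    HasFourierTransform (fun x => (fanBackprojection D w x : ℂ)) (fanSpectrum D w) :=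
  ⟨isTempered_of_integrable_mul (integrable_fanBackprojection_mul hD hw
      continuous_quadratic_weight norm_quadratic_weight_le),
    isTempered_of_integrable_mul (integrable_fanSpectrum_mul hw
      continuous_quadratic_weight norm_quadratic_weight_le),
    integral_fanBackprojection_mul_fourierPlane hD hw⟩

lemma fanSpectrum_smul_xi (hw : IsStandardSinogram w) {σ : ℝ} (hσ : 0 < σ) (θ : ℝ) :
    fanSpectrum D w (σ • xi θ) = 1 / (σ : ℂ) * ∫ γ in (0 : ℝ)..(2 * Real.pi),
      (sheared w γ θ : ℂ) * exp (-(I * (D * σ * Real.sin γ : ℝ))) := by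
  have hz : σ • xi θ = planeIso (σ * exp (θ * I)) := by
    rw [xi_eq_planeIso, ← LinearIsometryEquiv.map_smul, real_smul]
  have hn : ‖σ • xi θ‖ = σ := by
    rw [hz, LinearIsometryEquiv.norm_map, norm_mul, norm_exp_ofReal_mul_I, mul_one, norm_real,
      Real.norm_of_nonneg hσ.le]
  have hZ : ∀ γ, sheared w γ (arg (planeIso.symm (σ • xi θ))) = sheared w γ θ := fun γ => by
    rw [hz, LinearIsometryEquiv.symm_apply_apply, arg_real_mul _ hσ, arg_exp_mul_I,
      toIocMod, zsmul_eq_mul]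
    -- the principal argument differs from `θ` by a multiple of `2π`
    exact (hw.sheared_periodic_snd γ).sub_int_mul_eq _
  rw [fanSpectrum, hn]
  simp only [hZ]
  rw [ofReal_inv, one_div]

end Square

end FanBeam

end

theorem mainTheorem1 (D : ℝ) (hD : 0 < D) (w : ℝ → ℝ → ℝ)
    (hw : FanBeam.IsStandardSinogram w) :
    ∃ F : FanBeam.Plane → ℂ,
      FanBeam.HasFourierTransform (fun x => (FanBeam.fanBackprojection D w x : ℂ)) F ∧
      ∀ σ θ : ℝ, 0 < σ →
        Summable (fun n : ℕ => FanBeam.coeffB w n θ * (FanBeam.besselJ n (D * σ) : ℂ)) ∧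
        F (σ • FanBeam.xi θ) =
          1 / (σ : ℂ) * ∑' n : ℕ, FanBeam.coeffB w n θ * (FanBeam.besselJ n (D * σ) : ℂ) := by
  refine ⟨FanBeam.fanSpectrum D w, FanBeam.hasFourierTransform_fanBackprojection hD hw,
    fun σ θ hσ => ?_⟩
  have h := FanBeam.hasSum_coeffB_mul_besselJ w θ (D * σ)
  exact ⟨h.summable, by rw [FanBeam.fanSpectrum_smul_xi hw hσ, h.tsum_eq]⟩
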